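/- **Setting.** Let $N\ge 2$, let $\Omega\subset\mathbb R^N$ be open and bounded, $1<p<N$, $p^*=\frac{Np}{N-p}$, $\gamma_2\ge 0$ and $0\le\theta<1+\frac{\gamma_2}{p-1}$. Let $a:\Omega\times\mathbb R\times\mathbb R^N\to\mathbb R^N$ be a Carathéodory function and $b:\mathbb R\to\mathbb R$ a continuous bounded function such that, for some $\alpha>0$, $$a(x,s,\xi)\cdot\xi\ge b(s)|\xi|^p,\qquad b(s)\ge\frac{\alpha}{(1+|s|)^{\theta(p-1)}}$$ for almost every $x\in\Omega$ and all $s\in\mathbb R$, $\xi\in\mathbb R^N$. Let $h:[0,\infty)\to[0,\infty]$ be continuous and finite on $(0,\infty)$, and suppose that there are $c_2,s_2>0$ with $h(s)\le c_2 s^{-\gamma_2}$ for all $s\ge s_2$. Let $m\ge 1$ and let $0\le f\in L^m(\Omega)$. For $k>0$ let $T_k(s)=\max(-k,\min(s,k))$. If $u$ is measurable and $T_k(u)\in W^{1,1}_{\rm loc}(\Omega)$ for every $k>0$, then $\nabla u$ denotes the (almost everywhere unique) measurable $v:\Omega\to\mathbb R^N$ with $\nabla T_k(u)=v\chi_{\{|u|\le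 k\}}$ a.e. in $\Omega$ for every $k>0$. A nonnegative, measurable, almost everywhere finite function $u$ is an *entropy solution* of $$-\operatorname{div}(a(x,u,\nabla u))=h(u)f\ \text{ in }\Omega,\qquad u\ge 0\ \text{ in }\Omega,\qquad u=0\ \text{ on }\partial\Omega,$$ if $T_k(u)\in W^{1,p}_0(\Omega)$ and $a(x,T_k(u),\nabla T_k(u))\in L^{\frac p{p-1}}(\Omega)^N$ for every $k>0$, and if, for every $k>0$ and every $\varphi\in W^{1,p}_0(\Omega)\cap L^\infty(\Omega)$, $h(u)fT_k(u-\varphi)\in L^1(\Omega)$ (with $\infty\cdot 0=0$) and $$\int_\Omega a(x,u,\nabla u)\cdot\nabla T_k(u-\varphi)\le\int_\Omega h(u)fT_k(u-\varphi).$$ **Lemma 5.5.** Every entropy solution $u$ has the following properties. - If $1<m<\frac Np$, then $u^{\frac{Nm((p-1)(1-\theta)+\gamma_2)}{N-mp}}\in L^1(\Omega)$. - (i) If $m\ge\max\left(\frac{p^*}{p^*-\theta(p-1)-1+\gamma_2},1\right)$, then $u\in W^{1,p}_0(\Omega)$. - (ii) If $1<m<\frac{p^*}{p^*-\theta(p-1)-1+\gamma_2}$,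 then $|\nabla u|^{\frac{Nm((p-1)(1-\theta)+\gamma_2)}{N-m(\theta(p-1)+1-\gamma_2)}}\in L^1(\Omega)$. -/

import Mathlib

open MeasureTheory Filter Topology Set
open scoped ENNReal NNReal ContDiff

noncomputable section

/-- The truncation at level `k`: `T_k(s) = max (-k, min (s, k))`. -/
def truncAt (k s : ℝ) : ℝ := max (-k) (min s k)

/-- `ψ` is a test function on `Ω`: smooth, with compact support contained in `Ω`. -/
def IsTestFun {N : ℕ} (Ω : Set (EuclideanSpace ℝ (Fin N)))
    (ψ : EuclideanSpace ℝ (Fin N) → ℝ) : Prop :=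
  ContDiff ℝ ∞ ψ ∧ HasCompactSupport ψ ∧ tsupport ψ ⊆ Ω

/-- `w` belongs to `W^{1,1}_loc(Ω)` and `g` is its weak (distributional) gradient on `Ω`. -/
def HasWeakGrad {N : ℕ} (Ω : Set (EuclideanSpace ℝ (Fin N)))
    (w : EuclideanSpace ℝ (Fin N) → ℝ)
    (g : EuclideanSpace ℝ (Fin N) → EuclideanSpace ℝ (Fin N)) : Prop :=
  LocallyIntegrableOn w Ω volume ∧ LocallyIntegrableOn g Ω volume ∧
    ∀ ψ : EuclideanSpace ℝ (Fin N) → ℝ, IsTestFun Ω ψ →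
      ∫ x in Ω, w x • gradient ψ x = - ∫ x in Ω, ψ x • g x

open scoped Classical in
/-- The weak gradient of `w` on `Ω` (unique up to null sets); by convention `0` if `w` has none. -/
def weakGrad {N : ℕ} (Ω : Set (EuclideanSpace ℝ (Fin N)))
    (w : EuclideanSpace ℝ (Fin N) → ℝ) :
    EuclideanSpace ℝ (Fin N) → EuclideanSpace ℝ (Fin N) :=
  if H : ∃ g, HasWeakGrad Ω w g then H.choose else 0

/-- `w ∈ W^{1,p}_0(Ω)`: `w` and its weak gradient `g` are in `L^p(Ω)`, and `w` is the limit, in the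
norm of `W^{1,p}(Ω)`, of a sequence of test functions on `Ω`. -/
def MemW0 {N : ℕ} (Ω : Set (EuclideanSpace ℝ (Fin N))) (p : ℝ)
    (w : EuclideanSpace ℝ (Fin N) → ℝ) : Prop :=
  ∃ g : EuclideanSpace ℝ (Fin N) → EuclideanSpace ℝ (Fin N),
    HasWeakGrad Ω w g ∧
    MemLp w (ENNReal.ofReal p) (volume.restrict Ω) ∧
    MemLp g (ENNReal.ofReal p) (volume.restrict Ω) ∧
    ∃ ψ : ℕ → EuclideanSpace ℝ (Fin N) → ℝ, (∀ n, IsTestFun Ω (ψ n)) ∧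
      Tendsto (fun n => eLpNorm (fun x => w x - ψ n x) (ENNReal.ofReal p) (volume.restrict Ω))
        atTop (𝓝 0) ∧
      Tendsto (fun n => eLpNorm (fun x => g x - gradient (ψ n) x) (ENNReal.ofReal p)
        (volume.restrict Ω)) atTop (𝓝 0)

/-- `v` is the generalized gradient of `u` on `Ω`: all truncations of `u` are in `W^{1,1}_loc(Ω)`,
and `∇ T_k(u) = v χ_{|u| ≤ k}` for every `k > 0`. Neither `u` nor `v` need be locally integrable. -/
def IsTruncGrad {N : ℕ} (Ω : Set (EuclideanSpace ℝ (Fin N)))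
    (u : EuclideanSpace ℝ (Fin N) → ℝ)
    (v : EuclideanSpace ℝ (Fin N) → EuclideanSpace ℝ (Fin N)) : Prop :=
  AEStronglyMeasurable v (volume.restrict Ω) ∧
    ∀ k : ℝ, 0 < k → HasWeakGrad Ω (fun x => truncAt k (u x)) ({x | |u x| ≤ k}.indicator v)

open scoped Classical in
/-- The generalized gradient of `u` on `Ω` (unique up to null sets, and existing as soon as all
truncations of `u` are in `W^{1,1}_loc(Ω)`); by convention `0` if `u` has none. -/
def truncGrad {N : ℕ} (Ω : Set (EuclideanSpace ℝ (Fin N)))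
    (u : EuclideanSpace ℝ (Fin N) → ℝ) :
    EuclideanSpace ℝ (Fin N) → EuclideanSpace ℝ (Fin N) :=
  if H : ∃ v, IsTruncGrad Ω u v then H.choose else 0

/-- `a : Ω × ℝ × ℝ^N → ℝ^N` is a Carathéodory function: measurable in `x` for every `(s, ξ)`,
continuous in `(s, ξ)` for almost every `x ∈ Ω`. -/
def IsCaratheodory {N : ℕ} (Ω : Set (EuclideanSpace ℝ (Fin N)))
    (a : EuclideanSpace ℝ (Fin N) → ℝ → EuclideanSpace ℝ (Fin N) → EuclideanSpace ℝ (Fin N)) :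
    Prop :=
  (∀ (s : ℝ) (ξ : EuclideanSpace ℝ (Fin N)),
      AEStronglyMeasurable (fun x => a x s ξ) (volume.restrict Ω)) ∧
    ∀ᵐ x ∂(volume.restrict Ω),
      Continuous (fun z : ℝ × EuclideanSpace ℝ (Fin N) => a x z.1 z.2)

/-- The right-hand side `h(u) f`, with values in `[0, ∞]` (and `∞ · 0 = 0`), for `u, f ≥ 0`. -/
def sourceTerm {N : ℕ} (h : ℝ≥0 → ℝ≥0∞) (f u : EuclideanSpace ℝ (Fin N) → ℝ)
    (x : EuclideanSpace ℝ (Fin N)) : ℝ≥0∞ :=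
  h (u x).toNNReal * ENNReal.ofReal (f x)

/-- `u` is an entropy solution of `-div a(x, u, ∇u) = h(u) f` in `Ω`, `u ≥ 0` in `Ω`, `u = 0` on
`∂Ω`, for `f ≥ 0`. (An almost everywhere finite function is represented by a real-valued one.) -/
structure IsEntropySolution {N : ℕ} (Ω : Set (EuclideanSpace ℝ (Fin N))) (p : ℝ)
    (a : EuclideanSpace ℝ (Fin N) → ℝ → EuclideanSpace ℝ (Fin N) → EuclideanSpace ℝ (Fin N))
    (h : ℝ≥0 → ℝ≥0∞) (f u : EuclideanSpace ℝ (Fin N) → ℝ) : Prop where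
  aemeasurable : AEMeasurable u (volume.restrict Ω)
  nonneg : ∀ᵐ x ∂(volume.restrict Ω), 0 ≤ u x
  memW0_trunc : ∀ k : ℝ, 0 < k → MemW0 Ω p (fun x => truncAt k (u x))
  memLp_flux : ∀ k : ℝ, 0 < k →
    MemLp (fun x => a x (truncAt k (u x)) (weakGrad Ω (fun y => truncAt k (u y)) x))
      (ENNReal.ofReal (p / (p - 1))) (volume.restrict Ω)
  /-- `h(u) f T_k(u - φ) ∈ L^1(Ω)`; in particular this product is finite almost everywhere. -/
  integrable_source : ∀ k : ℝ, 0 < k → ∀ φ : EuclideanSpace ℝ (Fin N) → ℝ,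
    MemW0 Ω p φ → MemLp φ ⊤ (volume.restrict Ω) →
      AEMeasurable (sourceTerm h f u) (volume.restrict Ω) ∧
      ∫⁻ x in Ω, sourceTerm h f u x * ‖truncAt k (u x - φ x)‖ₑ < ⊤
  /-- The entropy inequality. By the previous condition `h(u) f` is finite almost everywhere on
  `{T_k(u - φ) ≠ 0}`, so that `toReal` does not alter the product `h(u) f T_k(u - φ)`. -/
  entropy_le : ∀ k : ℝ, 0 < k → ∀ φ : EuclideanSpace ℝ (Fin N) → ℝ,
    MemW0 Ω p φ → MemLp φ ⊤ (volume.restrict Ω) →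
      ∫ x in Ω, inner ℝ (a x (u x) (truncGrad Ω u x))
          (weakGrad Ω (fun y => truncAt k (u y - φ y)) x)
        ≤ ∫ x in Ω, (sourceTerm h f u x).toReal * truncAt k (u x - φ x)

/-- The Sobolev conjugate exponent `p^* = N p / (N - p)` (for `1 ≤ p < N`). -/
def sobolevConj (N : ℕ) (p : ℝ) : ℝ := N * p / (N - p)

end

/-! Write τ = θ(p-1), q = p^*, ⟨s⟩ = (1+s²)^{1/2} and B = p-1-τ+γ₂, which is positive by the bound
on θ. Testing the entropy inequality at level t ≥ s₂ with φ = T_t(u) confines its left side to the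
layer {t < u ≤ 2t}, and gives ∫_{t<u≤2t} b(u)|∇u|^p ≤ c₂ t ∫_{u>t} f u^{-γ₂}
(`IsEntropySolution.lintegral_layer_le`). On the layer u is comparable with t. Multiplying by
t^{η-1} and summing over t = 2^i s₂ therefore bounds the energy with weight ⟨u⟩^{η-1-τ} by ∫_{u>s₂}
f u^{-γ₂} min(u, 2^j s₂)^η (`exists_weighted_energy_le`). Truncations alone thus yield what
unbounded power test functions would give formally.

With η = βp-(p-1-τ) the weight is ⟨u⟩^{(β-1)p}, so that, up to constants and the harmless region u ≤
s₂, the energy controls ∫|∇⟨u⟩^β|^p, and by Sobolev Y^{p/q}, where Y = ∫⟨T_k(u)⟩^{βq}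
(`exists_bracket_sobolev`). If βp ≤ B, the right side is bounded by the L^1 norm of f. Otherwise,
for f in L^r with (1-1/r)βq = βp-B, Hölder bounds it by ‖f‖_r Y^{1-1/r}; as B > 0, 1-1/r < p/q, and
since Y is finite at each truncation level it can be absorbed. Fatou removes the truncation
(`IsEntropySolution.lintegral_bracket_lt_top`).

The claims are choices of β. The choice r = m gives βq = NmB/(N-mp), the summability of u. The
choice β = 1 makes the weight trivial and gives (i). For (ii), the weighted energy for r = m is
interpolated with the summability of u by Young's inequality (`rpow_le_bracket_add_bracket`). -/

/-! ### Convergence in L^p. -/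

section LpConvergence

variable {X E : Type*} [MeasurableSpace X] {μ : Measure X} [NormedAddCommGroup E]

/-- Dominated convergence in `L^p`, `0 < p < ∞`. -/
lemma tendsto_eLpNorm_sub_of_dominated {P : ℝ≥0∞} (hP0 : P ≠ 0) (hPt : P ≠ ⊤)
    {f : ℕ → X → E} {g : X → E} {H : X → ℝ}
    (hf : ∀ n, AEStronglyMeasurable (f n) μ) (hg : AEStronglyMeasurable g μ) (hH : MemLp H P μ)
    (hdom : ∀ n, ∀ᵐ x ∂μ, ‖g x - f n x‖ ≤ H x)
    (hlim : ∀ᵐ x ∂μ, Tendsto (fun n => f n x) atTop (𝓝 (g x))) :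
    Tendsto (fun n => eLpNorm (fun x => g x - f n x) P μ) atTop (𝓝 0) := by
  have hpos : 0 < P.toReal := ENNReal.toReal_pos hP0 hPt
  have hint : Tendsto (fun n => ∫⁻ x, ‖g x - f n x‖ₑ ^ P.toReal ∂μ) atTop
      (𝓝 (∫⁻ _, (0 : ℝ≥0∞) ∂μ)) := by
    refine tendsto_lintegral_of_dominated_convergence' (fun x => ‖H x‖ₑ ^ P.toReal) ?_ ?_ ?_ ?_
    · intro n
      exact ((hg.sub (hf n)).enorm).pow_const _
    · intro n
      filter_upwards [hdom n] with x hx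
      refine ENNReal.rpow_le_rpow ?_ hpos.le
      rw [enorm_le_iff_norm_le]
      exact hx.trans (le_abs_self _)
    · exact (lintegral_rpow_enorm_lt_top_of_eLpNorm_lt_top hP0 hPt hH.2).ne
    · filter_upwards [hlim] with x hx
      have h1 : Tendsto (fun n => g x - f n x) atTop (𝓝 0) := by
        simpa using (tendsto_const_nhds (x := g x)).sub hx
      have h2 := (ENNReal.continuous_rpow_const (y := P.toReal)).tendsto _ |>.comp h1.enorm
      simpa [Function.comp_def, hpos] using h2
  have h3 := ((ENNReal.continuous_rpow_const (y := 1 / P.toReal)).tendsto _).comp hint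
  simp only [lintegral_zero, one_div] at h3
  rw [ENNReal.zero_rpow_of_pos (inv_pos.2 hpos)] at h3
  refine h3.congr fun n => ?_
  rw [eLpNorm_eq_lintegral_rpow_enorm_toReal hP0 hPt]
  simp

/-- A sequence converging in `L^p` has an almost everywhere convergent subsequence. -/
lemma exists_subseq_tendsto_ae_of_eLpNorm_sub {P : ℝ≥0∞} (hP0 : P ≠ 0)
    {f : ℕ → X → E} {g : X → E}
    (hf : ∀ n, AEStronglyMeasurable (f n) μ) (hg : AEStronglyMeasurable g μ)
    (h : Tendsto (fun n => eLpNorm (fun x => g x - f n x) P μ) atTop (𝓝 0)) :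
    ∃ ns : ℕ → ℕ, StrictMono ns ∧
      ∀ᵐ x ∂μ, Tendsto (fun n => f (ns n) x) atTop (𝓝 (g x)) := by
  refine (tendstoInMeasure_of_tendsto_eLpNorm hP0 hf hg ?_).exists_seq_tendsto_ae
  refine h.congr fun n => ?_
  exact eLpNorm_sub_comm g (f n) P μ

/-- `L^p` convergence forces convergence of integrals dominated by the difference. -/
lemma tendsto_integral_of_eLpNorm_sub [IsFiniteMeasure μ] {P : ℝ≥0∞} (hP1 : 1 ≤ P)
    {G : Type*} [NormedAddCommGroup G] [NormedSpace ℝ G]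
    {f : ℕ → X → E} {g : X → E} {φ : ℕ → X → G} {ψ : X → G} {C : ℝ}
    (hf : ∀ n, AEStronglyMeasurable (f n) μ) (hg : AEStronglyMeasurable g μ)
    (h : Tendsto (fun n => eLpNorm (fun x => g x - f n x) P μ) atTop (𝓝 0))
    (hφ : ∀ n, Integrable (φ n) μ) (hψ : Integrable ψ μ)
    (hle : ∀ n x, ‖φ n x - ψ x‖ ≤ C * ‖g x - f n x‖) :
    Tendsto (fun n => ∫ x, φ n x ∂μ) atTop (𝓝 (∫ x, ψ x ∂μ)) := by
  refine tendsto_integral_of_L1 ψ hψ.1 (Eventually.of_forall hφ) ?_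
  set K : ℝ≥0∞ := ENNReal.ofReal C * (μ univ) ^ (1 / (1 : ℝ≥0∞).toReal - 1 / P.toReal) with hK
  have hKt : K ≠ ⊤ := by
    refine ENNReal.mul_ne_top ENNReal.ofReal_ne_top (ENNReal.rpow_ne_top_of_nonneg ?_
      (measure_ne_top μ _))
    simp only [ENNReal.toReal_one, div_one, one_div, sub_nonneg]
    -- For `P = ⊤` the convention `P.toReal = 0` makes `P.toReal⁻¹` equal to 0, as it should be.
    by_cases hPt : P = ⊤
    · simp [hPt]
    · exact inv_le_one_of_one_le₀ (by simpa using ENNReal.toReal_mono hPt hP1)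
  have hlim : Tendsto (fun n => K * eLpNorm (fun x => g x - f n x) P μ) atTop (𝓝 0) := by
    simpa using ENNReal.Tendsto.const_mul h (Or.inr hKt)
  refine tendsto_of_tendsto_of_tendsto_of_le_of_le tendsto_const_nhds hlim
    (fun _ => zero_le) fun n => ?_
  rw [← eLpNorm_one_eq_lintegral_enorm]
  calc eLpNorm (fun x => φ n x - ψ x) 1 μ
      ≤ ENNReal.ofReal C * eLpNorm (fun x => g x - f n x) 1 μ :=
        eLpNorm_le_mul_eLpNorm_of_ae_le_mul (Eventually.of_forall (hle n)) 1
    _ ≤ ENNReal.ofReal C * (eLpNorm (fun x => g x - f n x) P μ *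
          (μ univ) ^ (1 / (1 : ℝ≥0∞).toReal - 1 / P.toReal)) := by
        gcongr
        exact eLpNorm_le_eLpNorm_mul_rpow_measure_univ hP1 (hg.sub (hf n))
    _ = K * eLpNorm (fun x => g x - f n x) P μ := by rw [hK]; ring

end LpConvergence

/-! ### Weak gradients and limits of test functions. -/

section Gradient

variable {N : ℕ} {Ω : Set (EuclideanSpace ℝ (Fin N))}

lemma IsTestFun.continuous_gradient {ψ : EuclideanSpace ℝ (Fin N) → ℝ} (h : IsTestFun Ω ψ) :
    Continuous (gradient ψ) := by
  have := h.1.continuous_fderiv (by simp)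
  exact (InnerProductSpace.toDual ℝ (EuclideanSpace ℝ (Fin N))).symm.continuous.comp this

lemma gradient_eq_zero_of_notMem_tsupport {ψ : EuclideanSpace ℝ (Fin N) → ℝ}
    {x : EuclideanSpace ℝ (Fin N)} (hx : x ∉ tsupport ψ) :
    gradient ψ x = 0 := by
  have h : fderiv ℝ ψ x = 0 := by
    by_contra h
    exact hx (support_fderiv_subset ℝ (f := ψ) h)
  simp [gradient, h]

lemma IsTestFun.gradient_eq_zero {ψ : EuclideanSpace ℝ (Fin N) → ℝ}
    (h : IsTestFun Ω ψ) {x : EuclideanSpace ℝ (Fin N)}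
    (hx : x ∉ Ω) : gradient ψ x = 0 :=
  gradient_eq_zero_of_notMem_tsupport fun h' => hx (h.2.2 h')

lemma IsTestFun.eq_zero {ψ : EuclideanSpace ℝ (Fin N) → ℝ}
    (h : IsTestFun Ω ψ) {x : EuclideanSpace ℝ (Fin N)}
    (hx : x ∉ Ω) : ψ x = 0 :=
  image_eq_zero_of_notMem_tsupport fun h' => hx (h.2.2 h')

lemma IsTestFun.hasCompactSupport_gradient {ψ : EuclideanSpace ℝ (Fin N) → ℝ}
    (h : IsTestFun Ω ψ) :
    HasCompactSupport (gradient ψ) :=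
  HasCompactSupport.intro h.2.1 fun _ hx => gradient_eq_zero_of_notMem_tsupport hx

lemma IsTestFun.exists_bound {ψ : EuclideanSpace ℝ (Fin N) → ℝ} (h : IsTestFun Ω ψ) :
    ∃ C, ∀ x, ‖ψ x‖ ≤ C :=
  h.2.1.exists_bound_of_continuous h.1.continuous

lemma IsTestFun.exists_bound_gradient {ψ : EuclideanSpace ℝ (Fin N) → ℝ} (h : IsTestFun Ω ψ) :
    ∃ C, ∀ x, ‖gradient ψ x‖ ≤ C :=
  h.hasCompactSupport_gradient.exists_bound_of_continuous h.continuous_gradient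

lemma norm_gradient (ψ : EuclideanSpace ℝ (Fin N) → ℝ)
    (x : EuclideanSpace ℝ (Fin N)) : ‖gradient ψ x‖ = ‖fderiv ℝ ψ x‖ := by
  simp [gradient]

/-- Integration by parts for two test functions. -/
lemma IsTestFun.integral_smul_gradient {ψ φ : EuclideanSpace ℝ (Fin N) → ℝ}
    (hψ : IsTestFun Ω ψ) (hφ : IsTestFun Ω φ) :
    ∫ x in Ω, ψ x • gradient φ x = - ∫ x in Ω, φ x • gradient ψ x := by
  rw [setIntegral_eq_integral_of_forall_compl_eq_zero
      (fun x hx => by rw [hψ.eq_zero hx, zero_smul]),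
    setIntegral_eq_integral_of_forall_compl_eq_zero
      (fun x hx => by rw [hφ.eq_zero hx, zero_smul])]
  have key : ∀ {ψ φ : EuclideanSpace ℝ (Fin N) → ℝ}, IsTestFun Ω ψ → IsTestFun Ω φ →
      Integrable (fun x => ψ x • gradient φ x) := fun {ψ φ} hψ hφ =>
    (hψ.1.continuous.smul hφ.continuous_gradient).integrable_of_hasCompactSupport
      (hψ.2.1.smul_right)
  -- Pairing with a fixed vector `v` reduces the claim to scalar integration by parts in direction
  -- `v`.
  refine ext_inner_left ℝ fun v => ?_
  rw [inner_neg_right, ← integral_inner (key hψ hφ), ← integral_inner (key hφ hψ)]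
  have kf : ∀ {ψ φ : EuclideanSpace ℝ (Fin N) → ℝ}, IsTestFun Ω ψ → IsTestFun Ω φ →
      Integrable (fun x => ψ x * fderiv ℝ φ x v) := fun {ψ φ} hψ hφ => by
    simpa [inner_smul_right] using (key hψ hφ).const_inner (𝕜 := ℝ) v
  have h := integral_mul_fderiv_eq_neg_fderiv_mul_of_integrable (μ := volume) (f := ψ) (g := φ)
    (v := v) (by simpa [mul_comm] using kf hφ hψ) (kf hψ hφ)
    ((hψ.1.continuous.mul hφ.1.continuous).integrable_of_hasCompactSupport hψ.2.1.mul_right)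
    (fun x _ => (hψ.1.differentiable (by simp)) x) (fun x _ => (hφ.1.differentiable (by simp)) x)
  simpa [inner_smul_right, mul_comm] using h

/-- `(w, g)` is the limit in `L^p(Ω)` of test functions together with their gradients. -/
structure IsW0Limit (Ω : Set (EuclideanSpace ℝ (Fin N))) (p : ℝ) (w : EuclideanSpace ℝ (Fin N) → ℝ)
    (g : EuclideanSpace ℝ (Fin N) → EuclideanSpace ℝ (Fin N)) : Prop where
  memLp : MemLp w (ENNReal.ofReal p) (volume.restrict Ω)
  memLp_grad : MemLp g (ENNReal.ofReal p) (volume.restrict Ω)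
  exists_seq : ∃ ψ : ℕ → EuclideanSpace ℝ (Fin N) → ℝ, (∀ n, IsTestFun Ω (ψ n)) ∧
      Tendsto (fun n => eLpNorm (fun x => w x - ψ n x) (ENNReal.ofReal p) (volume.restrict Ω))
        atTop (𝓝 0) ∧
      Tendsto (fun n => eLpNorm (fun x => g x - gradient (ψ n) x) (ENNReal.ofReal p)
        (volume.restrict Ω)) atTop (𝓝 0)

variable {p : ℝ} {w w' : EuclideanSpace ℝ (Fin N) → ℝ}
  {g g' : EuclideanSpace ℝ (Fin N) → EuclideanSpace ℝ (Fin N)}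

lemma isFiniteMeasure_restrict_of_isBounded (hΩ : Bornology.IsBounded Ω) :
    IsFiniteMeasure (volume.restrict Ω) :=
  ⟨by simpa using hΩ.measure_lt_top⟩

lemma MemLp.locallyIntegrableOn_of_isBounded {G : Type*} [NormedAddCommGroup G]
    (hΩ : Bornology.IsBounded Ω) (hp : 1 ≤ p)
    {f : EuclideanSpace ℝ (Fin N) → G} (hf : MemLp f (ENNReal.ofReal p) (volume.restrict Ω)) :
    LocallyIntegrableOn f Ω volume := by
  have := isFiniteMeasure_restrict_of_isBounded hΩ
  have : IntegrableOn f Ω := hf.integrable (by simpa using hp)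
  exact this.locallyIntegrableOn

/-- Integration by parts passes to the L^p limit on a bounded set. The weak gradient clause of
`MemW0` is thus automatic, and it suffices to work with `IsW0Limit`. -/
lemma IsW0Limit.hasWeakGrad (hΩ : Bornology.IsBounded Ω) (hp : 1 ≤ p)
    (h : IsW0Limit Ω p w g) : HasWeakGrad Ω w g := by
  have := isFiniteMeasure_restrict_of_isBounded hΩ
  have hP1 : (1 : ℝ≥0∞) ≤ ENNReal.ofReal p := by simpa using hp
  refine ⟨MemLp.locallyIntegrableOn_of_isBounded hΩ hp h.memLp,
    MemLp.locallyIntegrableOn_of_isBounded hΩ hp h.memLp_grad, fun φ hφ => ?_⟩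
  obtain ⟨ψ, hψ, hw, hg⟩ := h.exists_seq
  obtain ⟨C, hC⟩ := hφ.exists_bound
  obtain ⟨D, hD⟩ := hφ.exists_bound_gradient
  have hwi : Integrable w (volume.restrict Ω) := h.memLp.integrable hP1
  have hgi : Integrable g (volume.restrict Ω) := h.memLp_grad.integrable hP1
  have l1 : Tendsto (fun n => ∫ x in Ω, ψ n x • gradient φ x) atTop
      (𝓝 (∫ x in Ω, w x • gradient φ x)) := by
    refine tendsto_integral_of_eLpNorm_sub (C := D) hP1 (f := ψ) (g := w)
      (fun n => (hψ n).1.continuous.aestronglyMeasurable) h.memLp.1 hw (fun n => ?_) ?_ ?_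
    · exact (((hψ n).1.continuous.smul hφ.continuous_gradient).integrable_of_hasCompactSupport
        (hψ n).2.1.smul_right).restrict
    · exact hwi.smul_bdd D hφ.continuous_gradient.aestronglyMeasurable (Eventually.of_forall hD)
    · intro n x
      rw [← sub_smul, norm_smul, mul_comm, norm_sub_rev]
      exact mul_le_mul_of_nonneg_right (hD x) (norm_nonneg _)
  have l2 : Tendsto (fun n => ∫ x in Ω, φ x • gradient (ψ n) x) atTop
      (𝓝 (∫ x in Ω, φ x • g x)) := by
    refine tendsto_integral_of_eLpNorm_sub (C := C) hP1 (f := fun n => gradient (ψ n)) (g := g)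
      (fun n => (hψ n).continuous_gradient.aestronglyMeasurable) h.memLp_grad.1 hg (fun n => ?_)
      ?_ ?_
    · exact ((hφ.1.continuous.smul (hψ n).continuous_gradient).integrable_of_hasCompactSupport
        hφ.2.1.smul_right).restrict
    · exact hgi.bdd_smul C hφ.1.continuous.aestronglyMeasurable (Eventually.of_forall hC)
    · intro n x
      rw [← smul_sub, norm_smul, norm_sub_rev]
      exact mul_le_mul_of_nonneg_right (hC x) (norm_nonneg _)
  refine tendsto_nhds_unique l1 (l2.neg.congr fun n => ?_)
  rw [(hψ n).integral_smul_gradient hφ]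

lemma IsW0Limit.memW0 (hΩ : Bornology.IsBounded Ω) (hp : 1 ≤ p)
    (h : IsW0Limit Ω p w g) : MemW0 Ω p w :=
  ⟨g, h.hasWeakGrad hΩ hp, h.memLp, h.memLp_grad, h.exists_seq⟩

lemma MemW0.exists_isW0Limit (h : MemW0 Ω p w) : ∃ g, IsW0Limit Ω p w g := by
  obtain ⟨g, -, h1, h2, h3⟩ := h
  exact ⟨g, h1, h2, h3⟩

lemma IsW0Limit.congr (h : IsW0Limit Ω p w g) (hw : w =ᵐ[volume.restrict Ω] w')
    (hg : g =ᵐ[volume.restrict Ω] g') : IsW0Limit Ω p w' g' := by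
  obtain ⟨ψ, hψ, h1, h2⟩ := h.exists_seq
  refine ⟨h.memLp.ae_eq hw, h.memLp_grad.ae_eq hg, ψ, hψ, h1.congr fun n => ?_,
    h2.congr fun n => ?_⟩
  · exact eLpNorm_congr_ae (by filter_upwards [hw] with x hx; rw [hx])
  · exact eLpNorm_congr_ae (by filter_upwards [hg] with x hx; rw [hx])

/-- Weak gradients are unique almost everywhere. -/
lemma HasWeakGrad.ae_eq (hΩ : IsOpen Ω) (h : HasWeakGrad Ω w g) (h' : HasWeakGrad Ω w' g')
    (hw : w =ᵐ[volume.restrict Ω] w') : g =ᵐ[volume.restrict Ω] g' := by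
  -- Fundamental lemma of the calculus of variations, applied to g - g'.
  have key := hΩ.ae_eq_zero_of_integral_contDiff_smul_eq_zero (μ := volume)
    (f := fun x => g x - g' x) (h.2.1.sub h'.2.1) (fun φ h1 h2 h3 => ?_)
  · refine (ae_restrict_iff' hΩ.measurableSet).2 ?_
    filter_upwards [key] with x hx hxΩ
    exact sub_eq_zero.1 (hx hxΩ)
  · have hφ : IsTestFun Ω φ := ⟨h1, h2, h3⟩
    rw [← setIntegral_eq_integral_of_forall_compl_eq_zero (s := Ω)
      (fun x hx => by rw [hφ.eq_zero hx, zero_smul])]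
    have e1 := h.2.2 φ hφ
    have e2 := h'.2.2 φ hφ
    have e3 : ∫ x in Ω, w x • gradient φ x = ∫ x in Ω, w' x • gradient φ x :=
      integral_congr_ae (by filter_upwards [hw] with x hx; rw [hx])
    have hint : ∀ {f : EuclideanSpace ℝ (Fin N) → EuclideanSpace ℝ (Fin N)},
        LocallyIntegrableOn f Ω volume →
        IntegrableOn (fun x => φ x • f x) Ω := fun {f} hf => by
      have hfi : IntegrableOn f (tsupport φ) := hf.integrableOn_compact_subset h3 h2
      obtain ⟨C, hC⟩ := hφ.exists_bound
      have : IntegrableOn (fun x => φ x • f x) (tsupport φ) :=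
        hfi.bdd_smul C h1.continuous.aestronglyMeasurable (Eventually.of_forall hC)
      refine Integrable.restrict ((integrableOn_iff_integrable_of_support_subset
        (s := tsupport φ) fun x hx => subset_tsupport φ fun h0 => hx ?_).1 this)
      simp [h0]
    simp only [smul_sub]
    rw [integral_sub (hint h.2.1) (hint h'.2.1)]
    have : (∫ x in Ω, φ x • g x) = ∫ x in Ω, φ x • g' x := by
      rw [← neg_inj, ← e1, ← e2, e3]
    rw [this, sub_self]

lemma HasWeakGrad.weakGrad_ae_eq (hΩ : IsOpen Ω) (h : HasWeakGrad Ω w g) :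
    weakGrad Ω w =ᵐ[volume.restrict Ω] g := by
  have H : ∃ g, HasWeakGrad Ω w g := ⟨g, h⟩
  rw [weakGrad, dif_pos H]
  exact H.choose_spec.ae_eq hΩ h (EventuallyEq.refl _ _)

/-- The set of pairs `(w, ∇w)`, `w ∈ W^{1,p}_0(Ω)`, is closed in `L^p`. -/
lemma IsW0Limit.of_tendsto (hp : 1 ≤ p) {u : ℕ → EuclideanSpace ℝ (Fin N) → ℝ}
    {v : ℕ → EuclideanSpace ℝ (Fin N) → EuclideanSpace ℝ (Fin N)}
    (h : ∀ n, IsW0Limit Ω p (u n) (v n))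
    (hw : MemLp w (ENNReal.ofReal p) (volume.restrict Ω))
    (hg : MemLp g (ENNReal.ofReal p) (volume.restrict Ω))
    (hu : Tendsto (fun n => eLpNorm (fun x => w x - u n x) (ENNReal.ofReal p)
      (volume.restrict Ω)) atTop (𝓝 0))
    (hv : Tendsto (fun n => eLpNorm (fun x => g x - v n x) (ENNReal.ofReal p)
      (volume.restrict Ω)) atTop (𝓝 0)) : IsW0Limit Ω p w g := by
  have hP1 : (1 : ℝ≥0∞) ≤ ENNReal.ofReal p := by simpa using hp
  -- Diagonal choice: a test function within 1/(n+1) of the n-th pair, for function and gradient at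
  -- once.
  have hch : ∀ n : ℕ, ∃ ψ, IsTestFun Ω ψ ∧
      eLpNorm (fun x => u n x - ψ x) (ENNReal.ofReal p) (volume.restrict Ω) ≤ ((n : ℝ≥0∞) + 1)⁻¹ ∧
      eLpNorm (fun x => v n x - gradient ψ x) (ENNReal.ofReal p) (volume.restrict Ω)
        ≤ ((n : ℝ≥0∞) + 1)⁻¹ := by
    intro n
    obtain ⟨ψ, hψ, h1, h2⟩ := (h n).exists_seq
    have hpos : (0 : ℝ≥0∞) < ((n : ℝ≥0∞) + 1)⁻¹ := by
      simp [ENNReal.inv_pos]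
    obtain ⟨k, hk1, hk2⟩ := ((h1.eventually_le_const hpos).and (h2.eventually_le_const hpos)).exists
    exact ⟨ψ k, hψ k, hk1, hk2⟩
  choose ψ hψ h1 h2 using hch
  have hinv : Tendsto (fun n : ℕ => ((n : ℝ≥0∞) + 1)⁻¹) atTop (𝓝 0) := by
    have := (tendsto_add_atTop_iff_nat 1).2 ENNReal.tendsto_inv_nat_nhds_zero
    simpa using this
  refine ⟨hw, hg, ψ, hψ, ?_, ?_⟩
  · refine tendsto_of_tendsto_of_tendsto_of_le_of_le tendsto_const_nhds
      (by simpa using hu.add hinv) (fun _ => zero_le) fun n => ?_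
    calc eLpNorm (fun x => w x - ψ n x) (ENNReal.ofReal p) (volume.restrict Ω)
        = eLpNorm ((fun x => w x - u n x) + fun x => u n x - ψ n x) (ENNReal.ofReal p)
          (volume.restrict Ω) := by congr 1; ext x; simp
      _ ≤ _ := (eLpNorm_add_le (hw.1.sub (h n).memLp.1)
          ((h n).memLp.1.sub (hψ n).1.continuous.aestronglyMeasurable) hP1).trans
          (add_le_add le_rfl (h1 n))
  · refine tendsto_of_tendsto_of_tendsto_of_le_of_le tendsto_const_nhds
      (by simpa using hv.add hinv) (fun _ => zero_le) fun n => ?_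
    calc eLpNorm (fun x => g x - gradient (ψ n) x) (ENNReal.ofReal p) (volume.restrict Ω)
        = eLpNorm ((fun x => g x - v n x) + fun x => v n x - gradient (ψ n) x) (ENNReal.ofReal p)
          (volume.restrict Ω) := by congr 1; ext x; simp
      _ ≤ _ := (eLpNorm_add_le (hg.1.sub (h n).memLp_grad.1)
          ((h n).memLp_grad.1.sub (hψ n).continuous_gradient.aestronglyMeasurable) hP1).trans
          (add_le_add le_rfl (h2 n))

end Gradient

/-! ### Chain rule and truncation in W^{1,p}_0. -/

section Chain

variable {N : ℕ} {Ω : Set (EuclideanSpace ℝ (Fin N))} {p : ℝ}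
  {w w' : EuclideanSpace ℝ (Fin N) → ℝ}
  {g g' : EuclideanSpace ℝ (Fin N) → EuclideanSpace ℝ (Fin N)}

lemma gradient_comp_real {F : ℝ → ℝ} {ψ : EuclideanSpace ℝ (Fin N) → ℝ}
    {x : EuclideanSpace ℝ (Fin N)} (hF : DifferentiableAt ℝ F (ψ x))
    (hψ : DifferentiableAt ℝ ψ x) :
    gradient (fun y => F (ψ y)) x = deriv F (ψ x) • gradient ψ x := by
  have h : fderiv ℝ (fun y => F (ψ y)) x = deriv F (ψ x) • fderiv ℝ ψ x :=
    (hF.hasDerivAt.comp_hasFDerivAt x hψ.hasFDerivAt).fderiv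
  simp [gradient, h]

lemma IsTestFun.comp_left {F : ℝ → ℝ} (hF : ContDiff ℝ ∞ F) (hF0 : F 0 = 0)
    {ψ : EuclideanSpace ℝ (Fin N) → ℝ} (hψ : IsTestFun Ω ψ) :
    IsTestFun Ω (fun x => F (ψ x)) := by
  refine ⟨hF.comp hψ.1, hψ.2.1.comp_left hF0, subset_trans ?_ hψ.2.2⟩
  refine closure_mono fun x hx h0 => hx ?_
  simp [h0, hF0]

lemma norm_sub_le_of_norm_deriv_le {F : ℝ → ℝ} {C : ℝ} (hF : Differentiable ℝ F)
    (hC : ∀ s, ‖deriv F s‖ ≤ C) (s t : ℝ) : ‖F s - F t‖ ≤ C * ‖s - t‖ :=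
  Convex.norm_image_sub_le_of_norm_deriv_le (fun x _ => hF x) (fun x _ => hC x) convex_univ
    (mem_univ _) (mem_univ _)

/-- Pointwise convergence is what lets F'(ψ_n) converge in the chain rule and Fatou apply in
Sobolev's inequality. -/
lemma IsW0Limit.exists_seq_ae (hp : 1 ≤ p) (h : IsW0Limit Ω p w g) :
    ∃ ψ : ℕ → EuclideanSpace ℝ (Fin N) → ℝ, (∀ n, IsTestFun Ω (ψ n)) ∧
      Tendsto (fun n => eLpNorm (fun x => w x - ψ n x) (ENNReal.ofReal p) (volume.restrict Ω))
        atTop (𝓝 0) ∧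
      Tendsto (fun n => eLpNorm (fun x => g x - gradient (ψ n) x) (ENNReal.ofReal p)
        (volume.restrict Ω)) atTop (𝓝 0) ∧
      ∀ᵐ x ∂(volume.restrict Ω), Tendsto (fun n => ψ n x) atTop (𝓝 (w x)) := by
  obtain ⟨ψ, hψ, hw, hg⟩ := h.exists_seq
  obtain ⟨ns, hns, hae⟩ := exists_subseq_tendsto_ae_of_eLpNorm_sub
    (P := ENNReal.ofReal p) (by simpa using by linarith)
    (fun n => (hψ n).1.continuous.aestronglyMeasurable) h.memLp.1 hw
  exact ⟨fun n => ψ (ns n), fun n => hψ _, hw.comp hns.tendsto_atTop, hg.comp hns.tendsto_atTop,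
    hae⟩

/-- Chain rule in `W^{1,p}_0` for smooth functions with bounded derivative. -/
lemma IsW0Limit.comp_of_deriv_bounded (hp : 1 ≤ p) (h : IsW0Limit Ω p w g) {F : ℝ → ℝ}
    (hF : ContDiff ℝ ∞ F) (hF0 : F 0 = 0) {C : ℝ} (hC : ∀ s, ‖deriv F s‖ ≤ C) :
    IsW0Limit Ω p (fun x => F (w x)) (fun x => deriv F (w x) • g x) := by
  have hP1 : (1 : ℝ≥0∞) ≤ ENNReal.ofReal p := by simpa using hp
  have hP0 : ENNReal.ofReal p ≠ 0 := (zero_lt_one.trans_le hP1).ne'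
  have hFd : Differentiable ℝ F := hF.differentiable (by simp)
  have hF' : Continuous (deriv F) := hF.continuous_deriv (by simp)
  have hC0 : 0 ≤ C := (norm_nonneg _).trans (hC 0)
  have hle := norm_sub_le_of_norm_deriv_le hFd hC
  obtain ⟨ψ, hψ, hw, hg, hae⟩ := h.exists_seq_ae hp
  have hmg : AEStronglyMeasurable (fun x => deriv F (w x) • g x) (volume.restrict Ω) :=
    (hF'.comp_aestronglyMeasurable h.memLp.1).smul h.memLp_grad.1
  refine ⟨?_, ?_, fun n x => F (ψ n x), fun n => (hψ n).comp_left hF hF0, ?_, ?_⟩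
  · refine MemLp.of_le_mul (c := C) h.memLp (hFd.continuous.comp_aestronglyMeasurable h.memLp.1)
      (Eventually.of_forall fun x => ?_)
    simpa [hF0] using hle (w x) 0
  · refine MemLp.of_le_mul (c := C) h.memLp_grad hmg (Eventually.of_forall fun x => ?_)
    rw [norm_smul]
    exact mul_le_mul_of_nonneg_right (hC _) (norm_nonneg _)
  · have hlim : Tendsto (fun n => ENNReal.ofReal C * eLpNorm (fun x => w x - ψ n x)
        (ENNReal.ofReal p) (volume.restrict Ω)) atTop (𝓝 0) := by
      simpa using ENNReal.Tendsto.const_mul hw (Or.inr ENNReal.ofReal_ne_top)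
    exact tendsto_of_tendsto_of_tendsto_of_le_of_le tendsto_const_nhds hlim
      (fun _ => zero_le) fun n =>
        eLpNorm_le_mul_eLpNorm_of_ae_le_mul (Eventually.of_forall fun x => hle _ _) _
  -- Splitting F'(w)g - F'(ψ_n)∇ψ_n = (F'(w) - F'(ψ_n))g + F'(ψ_n)(g - ∇ψ_n): the first term tends
  -- to 0 by domination by 2C|g|, the second because F' is bounded.
  · have h1 : Tendsto (fun n => eLpNorm (fun x => deriv F (w x) • g x - deriv F (ψ n x) • g x)
        (ENNReal.ofReal p) (volume.restrict Ω)) atTop (𝓝 0) := by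
      refine tendsto_eLpNorm_sub_of_dominated hP0 ENNReal.ofReal_ne_top
        (H := fun x => (2 * C) * ‖g x‖) (fun n => ?_) hmg (h.memLp_grad.norm.const_mul _)
        (fun n => Eventually.of_forall fun x => ?_) ?_
      · exact ((hF'.comp (hψ n).1.continuous).aestronglyMeasurable).smul h.memLp_grad.1
      · rw [← sub_smul, norm_smul]
        gcongr
        exact (norm_sub_le _ _).trans (by linarith [hC (w x), hC (ψ n x)])
      · filter_upwards [hae] with x hx
        exact ((hF'.tendsto _).comp hx).smul_const _
    have h2 : Tendsto (fun n => ENNReal.ofReal C * eLpNorm (fun x => g x - gradient (ψ n) x)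
        (ENNReal.ofReal p) (volume.restrict Ω)) atTop (𝓝 0) := by
      simpa using ENNReal.Tendsto.const_mul hg (Or.inr ENNReal.ofReal_ne_top)
    refine tendsto_of_tendsto_of_tendsto_of_le_of_le tendsto_const_nhds
      (by simpa using h1.add h2) (fun _ => zero_le) fun n => ?_
    have hmn : AEStronglyMeasurable (fun x => deriv F (ψ n x) • g x) (volume.restrict Ω) :=
      ((hF'.comp (hψ n).1.continuous).aestronglyMeasurable).smul h.memLp_grad.1
    have hmn' : AEStronglyMeasurable (fun x => deriv F (ψ n x) • gradient (ψ n) x)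
        (volume.restrict Ω) :=
      ((hF'.comp (hψ n).1.continuous).smul (hψ n).continuous_gradient).aestronglyMeasurable
    calc eLpNorm (fun x => deriv F (w x) • g x - gradient (fun y => F (ψ n y)) x)
          (ENNReal.ofReal p) (volume.restrict Ω)
        = eLpNorm ((fun x => deriv F (w x) • g x - deriv F (ψ n x) • g x) +
            fun x => deriv F (ψ n x) • g x - deriv F (ψ n x) • gradient (ψ n) x)
          (ENNReal.ofReal p) (volume.restrict Ω) := by
          congr 1
          ext1 x
          rw [gradient_comp_real (hFd _) ((hψ n).1.differentiable (by simp) x)]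
          simp
      _ ≤ _ := (eLpNorm_add_le (hmg.sub hmn) (hmn.sub hmn') hP1).trans (add_le_add le_rfl
          (eLpNorm_le_mul_eLpNorm_of_ae_le_mul (Eventually.of_forall fun x => by
            rw [Pi.sub_apply, ← smul_sub, norm_smul]
            exact mul_le_mul_of_nonneg_right (hC _) (norm_nonneg _)) _))

/-- The primitive of `F'` cut off smoothly between levels `k` and `k + ε`. -/
lemma exists_contDiff_cutoff {F : ℝ → ℝ} (hF : ContDiff ℝ ∞ F) (hF0 : F 0 = 0) {k ε : ℝ}
    (hk : 0 < k) (hε : 0 < ε) :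
    ∃ (H χ : ℝ → ℝ), ContDiff ℝ ∞ H ∧ H 0 = 0 ∧ (∀ s, |s| ≤ k → H s = F s) ∧
      (∀ s, deriv H s = χ s * deriv F s) ∧ (∃ C, ∀ s, ‖deriv H s‖ ≤ C) ∧
      (∀ s, 0 ≤ χ s) ∧ (∀ s, χ s ≤ 1) ∧ (∀ s, |s| ≤ k → χ s = 1) ∧
      ∀ s, k + ε ≤ |s| → χ s = 0 := by
  let χ : ContDiffBump (0 : ℝ) := ⟨k, k + ε, hk, by linarith⟩
  have hF' : ContDiff ℝ ∞ (deriv F) := (contDiff_infty_iff_deriv.1 hF).2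
  have hc : ContDiff ℝ ∞ (fun t => χ t * deriv F t) := χ.contDiff.mul hF'
  have hder : ∀ s, HasDerivAt (fun s => ∫ t in (0 : ℝ)..s, χ t * deriv F t)
      (χ s * deriv F s) s := fun s =>
    intervalIntegral.integral_hasDerivAt_right (hc.continuous.intervalIntegrable _ _)
      (hc.continuous.stronglyMeasurableAtFilter _ _) hc.continuous.continuousAt
  have hone : ∀ s, |s| ≤ k → χ s = 1 := fun s hs =>
    χ.one_of_mem_closedBall (by simpa [Metric.mem_closedBall] using hs)
  have hd : ∀ s, deriv (fun s => ∫ t in (0 : ℝ)..s, χ t * deriv F t) s = χ s * deriv F s :=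
    fun s => (hder s).deriv
  refine ⟨fun s => ∫ t in (0 : ℝ)..s, χ t * deriv F t, χ, ?_, by simp, ?_, hd, ?_,
    fun s => χ.nonneg, fun s => χ.le_one, hone, ?_⟩
  · refine contDiff_infty_iff_deriv.2 ⟨fun s => (hder s).differentiableAt, ?_⟩
    rw [funext hd]
    exact hc
  · intro s hs
    have : ∫ t in (0 : ℝ)..s, χ t * deriv F t = ∫ t in (0 : ℝ)..s, deriv F t := by
      refine intervalIntegral.integral_congr fun t ht => ?_
      have : |t| ≤ k := by
        have h' := abs_sub_left_of_mem_uIcc ht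
        simp only [sub_zero] at h'
        exact h'.trans hs
      simp [hone t this]
    simp only [this]
    rw [intervalIntegral.integral_deriv_eq_sub (fun t _ => hF.differentiable (by simp) t)
      (hF'.continuous.intervalIntegrable _ _), hF0, sub_zero]
  · obtain ⟨C, hC⟩ := (χ.hasCompactSupport.mul_right (f' := deriv F)).exists_bound_of_continuous
      hc.continuous
    exact ⟨C, fun s => by rw [hd]; exact hC s⟩
  · intro s hs
    exact χ.zero_of_le_dist (by simpa using hs)

/-- Chain rule for bounded functions in `W^{1,p}_0`. -/
lemma IsW0Limit.comp_of_bounded (hp : 1 ≤ p) (h : IsW0Limit Ω p w g) {F : ℝ → ℝ}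
    (hF : ContDiff ℝ ∞ F) (hF0 : F 0 = 0) {k : ℝ} (hk : 0 < k)
    (hw : ∀ᵐ x ∂(volume.restrict Ω), |w x| ≤ k) :
    IsW0Limit Ω p (fun x => F (w x)) (fun x => deriv F (w x) • g x) := by
  obtain ⟨H, χ, hH, hH0, hHF, hd, ⟨C, hC⟩, -, -, hχ, -⟩ :=
    exists_contDiff_cutoff hF hF0 hk zero_lt_one
  refine (h.comp_of_deriv_bounded hp hH hH0 hC).congr ?_ ?_
  · filter_upwards [hw] with x hx using hHF _ hx
  · filter_upwards [hw] with x hx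
    rw [hd, hχ _ hx, one_mul]

lemma abs_truncAt_le {k : ℝ} (hk : 0 ≤ k) (s : ℝ) : |truncAt k s| ≤ k := by
  unfold truncAt
  rw [abs_le]
  exact ⟨le_max_left _ _, max_le (by linarith) (min_le_right _ _)⟩

lemma truncAt_of_abs_le {k s : ℝ} (h : |s| ≤ k) : truncAt k s = s := by
  rw [abs_le] at h
  simp [truncAt, h.1, h.2]

lemma continuous_truncAt (k : ℝ) : Continuous (truncAt k) := by
  unfold truncAt
  fun_prop

lemma abs_truncAt_le_abs {k : ℝ} (hk : 0 ≤ k) (s : ℝ) : |truncAt k s| ≤ |s| := by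
  unfold truncAt
  rcases max_cases (-k) (min s k) with h | h <;> rcases min_cases s k with h' | h' <;>
    rcases abs_cases s with h3 | h3 <;> rw [h.1] <;> try rw [h'.1]
  all_goals rw [abs_le]; constructor <;> linarith

/-- Smooth approximation of the truncation. -/
lemma exists_contDiff_truncAt {k ε : ℝ} (hk : 0 < k) (hε : 0 < ε) :
    ∃ H : ℝ → ℝ, ContDiff ℝ ∞ H ∧ H 0 = 0 ∧ (∀ s, ‖deriv H s‖ ≤ 1) ∧
      (∀ s, |s| ≤ k → deriv H s = 1) ∧ (∀ s, k + ε ≤ |s| → deriv H s = 0) ∧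
      ∀ s, ‖truncAt k s - H s‖ ≤ ε := by
  obtain ⟨H, χ, hH, hH0, hHF, hd, -, hχ0, hχ1, hχk, hχε⟩ :=
    exists_contDiff_cutoff (F := fun s => s) contDiff_id rfl hk hε
  simp only [deriv_id'', mul_one] at hd
  have hHd : Differentiable ℝ H := hH.differentiable (by simp)
  have hb : ∀ s, ‖deriv H s‖ ≤ 1 := fun s => by
    rw [hd, Real.norm_eq_abs, abs_of_nonneg (hχ0 s)]
    exact hχ1 s
  refine ⟨H, hH, hH0, hb, fun s hs => by rw [hd, hχk s hs],
    fun s hs => by rw [hd, hχε s hs], fun s => ?_⟩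
  -- H is constant beyond ±(k+ε), fixes [-k,k] and is 1-Lipschitz, so |T_k(s) - H(s)| ≤ |T_k(s) -
  -- T_{k+ε}(s)| ≤ ε.
  have hc : H s = H (truncAt (k + ε) s) := by
    have hconst : ∀ S : Set ℝ, Convex ℝ S → (∀ t ∈ S, k + ε ≤ |t|) → ∀ a ∈ S, ∀ b ∈ S,
        H a = H b := fun S hS hSt a ha b hb' => by
      have := hS.norm_image_sub_le_of_norm_deriv_le (f := H) (C := 0) (fun x _ => hHd x)
        (fun x hx => by rw [hd, hχε x (hSt x hx), norm_zero]) hb' ha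
      rw [zero_mul, norm_le_zero_iff, sub_eq_zero] at this
      exact this
    rcases le_total |s| (k + ε) with hs | hs
    · rw [truncAt_of_abs_le hs]
    · rcases le_abs.1 hs with h | h
      · have : truncAt (k + ε) s = k + ε := by
          simp only [truncAt, min_eq_right h]
          exact max_eq_right (by linarith)
        rw [this]
        exact hconst (Ici (k + ε)) (convex_Ici _)
          (fun t ht => (show k + ε ≤ t from ht).trans (le_abs_self t)) _ h _ self_mem_Ici
      · have : truncAt (k + ε) s = -(k + ε) := by
          simp only [truncAt]
          exact max_eq_left ((min_le_left _ _).trans (by linarith))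
        rw [this]
        refine hconst (Iic (-(k + ε))) (convex_Iic _) (fun t ht => ?_) _ ?_ _ self_mem_Iic
        · have : t ≤ -(k + ε) := ht
          exact le_trans (by linarith) (neg_le_abs t)
        · show s ≤ _
          linarith
  have hk' : H (truncAt k s) = truncAt k s := hHF _ (abs_truncAt_le hk.le s)
  rw [← hk', hc]
  refine (norm_sub_le_of_norm_deriv_le hHd hb _ _).trans ?_
  rw [one_mul, Real.norm_eq_abs, abs_le]
  unfold truncAt
  rcases max_cases (-k) (min s k) with h | h <;> rcases min_cases s k with h' | h' <;>
  rcases max_cases (-(k + ε)) (min s (k + ε)) with h3 | h3 <;>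
  rcases min_cases s (k + ε) with h4 | h4 <;> constructor <;> linarith

/-- Truncation in `W^{1,p}_0`. -/
lemma IsW0Limit.truncAt (hp : 1 ≤ p) (h : IsW0Limit Ω p w g) {k : ℝ} (hk : 0 < k) :
    IsW0Limit Ω p (fun x => truncAt k (w x)) ({x | |w x| ≤ k}.indicator g) := by
  have hP1 : (1 : ℝ≥0∞) ≤ ENNReal.ofReal p := by simpa using hp
  have hP0 : ENNReal.ofReal p ≠ 0 := (zero_lt_one.trans_le hP1).ne'
  have hε : ∀ n : ℕ, (0 : ℝ) < 1 / ((n : ℝ) + 1) := fun n => by positivity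
  choose H hH hH0 hHb hH1 hHz hHT using fun n => exists_contDiff_truncAt hk (hε n)
  have hlim0 : Tendsto (fun n : ℕ => (1 : ℝ) / ((n : ℝ) + 1)) atTop (𝓝 0) :=
    tendsto_one_div_add_atTop_nhds_zero_nat
  have hseq := fun n => h.comp_of_deriv_bounded hp (hH n) (hH0 n) (hHb n)
  have hset : NullMeasurableSet {x | |w x| ≤ k} (volume.restrict Ω) :=
    nullMeasurableSet_le h.memLp.1.aemeasurable.abs aemeasurable_const
  have hT : MemLp (fun x => _root_.truncAt k (w x)) (ENNReal.ofReal p) (volume.restrict Ω) :=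
    h.memLp.mono ((continuous_truncAt k).comp_aestronglyMeasurable h.memLp.1)
      (Eventually.of_forall fun x => abs_truncAt_le_abs hk.le _)
  have hG : MemLp ({x | |w x| ≤ k}.indicator g) (ENNReal.ofReal p) (volume.restrict Ω) :=
    h.memLp_grad.mono (h.memLp_grad.1.indicator₀ hset)
      (Eventually.of_forall fun x => norm_indicator_le_norm_self _ _)
  refine IsW0Limit.of_tendsto hp hseq hT hG ?_ ?_
  · refine tendsto_eLpNorm_sub_of_dominated hP0 ENNReal.ofReal_ne_top
      (H := fun x => ‖_root_.truncAt k (w x)‖ + ‖w x‖) (fun n => (hseq n).memLp.1) hT.1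
      (hT.norm.add h.memLp.norm) (fun n => Eventually.of_forall fun x => ?_)
      (Eventually.of_forall fun x => ?_)
    · refine (norm_sub_le _ _).trans (add_le_add le_rfl ?_)
      have := norm_sub_le_of_norm_deriv_le ((hH n).differentiable (by simp)) (hHb n) (w x) 0
      simpa [hH0] using this
    · rw [tendsto_iff_norm_sub_tendsto_zero]
      exact squeeze_zero (fun _ => norm_nonneg _)
        (fun n => (norm_sub_rev _ _).trans_le (hHT n _)) hlim0
  · refine tendsto_eLpNorm_sub_of_dominated hP0 ENNReal.ofReal_ne_top
      (H := fun x => ‖g x‖ + ‖g x‖) (fun n => (hseq n).memLp_grad.1) hG.1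
      (h.memLp_grad.norm.add h.memLp_grad.norm) (fun n => Eventually.of_forall fun x => ?_)
      (Eventually.of_forall fun x => ?_)
    · refine (norm_sub_le _ _).trans (add_le_add (norm_indicator_le_norm_self _ _) ?_)
      rw [norm_smul]
      exact mul_le_of_le_one_left (norm_nonneg _) (hHb n _)
    -- The derivative of every H_n is 1 on the closed interval |s| ≤ k, and for fixed |s| > k it
    -- eventually vanishes. The limit is thus exactly the indicator of {|w| ≤ k}, with no need to
    -- know that g = 0 a.e. on {|w| = k}.
    · by_cases hx : |w x| ≤ k
      · rw [indicator_of_mem (by exact hx)]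
        simp [hH1 _ _ hx]
      · rw [indicator_of_notMem (by exact hx)]
        refine tendsto_const_nhds.congr' ?_
        push Not at hx
        filter_upwards [hlim0.eventually_lt_const (sub_pos.2 hx)] with n hn
        rw [hHz n _ (by linarith), zero_smul]

end Chain

/-! ### Sobolev's inequality. -/

section Sobolev

variable {N : ℕ} {p : ℝ}

/-- Sobolev's inequality in `W^{1,p}_0(Ω)`. -/
lemma exists_sobolev_const (Ω : Set (EuclideanSpace ℝ (Fin N))) (hp : 1 ≤ p) (hpN : p < N) :
    ∃ C : ℝ≥0, ∀ (w : EuclideanSpace ℝ (Fin N) → ℝ)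
      (g : EuclideanSpace ℝ (Fin N) → EuclideanSpace ℝ (Fin N)), IsW0Limit Ω p w g →
      eLpNorm w (ENNReal.ofReal (sobolevConj N p)) (volume.restrict Ω) ≤
        C * eLpNorm g (ENNReal.ofReal p) (volume.restrict Ω) := by
  have hP1 : (1 : ℝ≥0∞) ≤ ENNReal.ofReal p := by simpa using hp
  have hN0 : (0 : ℝ) < N := by linarith
  have hp0 : 0 < p := by linarith
  have hs : 0 < sobolevConj N p := by
    unfold sobolevConj
    have : 0 < N - p := by linarith
    positivity
  refine ⟨SNormLESNormFDerivOfEqConst ℝ (volume : Measure (EuclideanSpace ℝ (Fin N)))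
    p.toNNReal, fun w g h => ?_⟩
  set C := SNormLESNormFDerivOfEqConst ℝ (volume : Measure (EuclideanSpace ℝ (Fin N))) p.toNNReal
  have htest : ∀ ψ : EuclideanSpace ℝ (Fin N) → ℝ, IsTestFun Ω ψ →
      eLpNorm ψ (ENNReal.ofReal (sobolevConj N p)) (volume.restrict Ω) ≤
        C * eLpNorm (gradient ψ) (ENNReal.ofReal p) (volume.restrict Ω) := fun ψ hψ => by
    have := eLpNorm_le_eLpNorm_fderiv_of_eq (μ := volume) (u := ψ) (p := p.toNNReal)
      (p' := (sobolevConj N p).toNNReal) (hψ.1.of_le (by simp)) hψ.2.1 (by simpa using hp)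
      (by simpa using hN0) (by
        rw [NNReal.coe_inv, Real.coe_toNNReal _ hp0.le, Real.coe_toNNReal _ hs.le,
          finrank_euclideanSpace_fin]
        unfold sobolevConj
        have : (N : ℝ) - p ≠ 0 := by linarith
        field_simp)
    have e : eLpNorm (fderiv ℝ ψ) (ENNReal.ofReal p) volume =
        eLpNorm (gradient ψ) (ENNReal.ofReal p) (volume.restrict Ω) := by
      rw [eLpNorm_restrict_eq_of_support_subset]
      · exact eLpNorm_congr_norm_ae (Eventually.of_forall fun x => (norm_gradient ψ x).symm)
      · intro x hx
        by_contra hxΩ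
        exact hx (hψ.gradient_eq_zero hxΩ)
    calc _ ≤ eLpNorm ψ (ENNReal.ofReal (sobolevConj N p)) volume :=
          eLpNorm_mono_measure _ Measure.restrict_le_self
      _ ≤ _ := this
      _ = _ := by rw [← e]; rfl
  -- Fatou along an a.e. convergent sequence: no convergence in L^{p^*} is required.
  obtain ⟨ψ, hψ, -, hg, hae⟩ := h.exists_seq_ae hp
  refine (Lp.eLpNorm_lim_le_liminf_eLpNorm
    (fun n => (hψ n).1.continuous.aestronglyMeasurable) w hae).trans ?_
  have hb : ∀ n, eLpNorm (ψ n) (ENNReal.ofReal (sobolevConj N p)) (volume.restrict Ω) ≤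
      C * (eLpNorm g (ENNReal.ofReal p) (volume.restrict Ω) +
        eLpNorm (fun x => g x - gradient (ψ n) x) (ENNReal.ofReal p) (volume.restrict Ω)) := by
    intro n
    refine (htest _ (hψ n)).trans ?_
    gcongr
    have : gradient (ψ n) = g - fun x => g x - gradient (ψ n) x := by ext1 x; simp
    conv_lhs => rw [this]
    exact eLpNorm_sub_le h.memLp_grad.1
      (h.memLp_grad.1.sub (hψ n).continuous_gradient.aestronglyMeasurable) hP1
  have hl : Tendsto (fun n => C * (eLpNorm g (ENNReal.ofReal p) (volume.restrict Ω) +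
        eLpNorm (fun x => g x - gradient (ψ n) x) (ENNReal.ofReal p) (volume.restrict Ω))) atTop
      (𝓝 (C * eLpNorm g (ENNReal.ofReal p) (volume.restrict Ω))) := by
    refine ENNReal.Tendsto.const_mul ?_ (Or.inr ENNReal.coe_ne_top)
    simpa using tendsto_const_nhds.add hg
  exact (liminf_le_liminf (Eventually.of_forall hb)).trans hl.liminf_eq.le

end Sobolev

/-! ### The generalized gradient. -/

section TruncGrad

variable {N : ℕ} {Ω : Set (EuclideanSpace ℝ (Fin N))} {p : ℝ}
  {w w' u : EuclideanSpace ℝ (Fin N) → ℝ}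
  {g g' : EuclideanSpace ℝ (Fin N) → EuclideanSpace ℝ (Fin N)}

lemma IsTestFun.sub {ψ φ : EuclideanSpace ℝ (Fin N) → ℝ} (hψ : IsTestFun Ω ψ)
    (hφ : IsTestFun Ω φ) : IsTestFun Ω (fun x => ψ x - φ x) :=
  ⟨hψ.1.sub hφ.1, hψ.2.1.sub hφ.2.1,
    (tsupport_sub ψ φ).trans (union_subset hψ.2.2 hφ.2.2)⟩

lemma IsW0Limit.sub (hp : 1 ≤ p) (h : IsW0Limit Ω p w g) (h' : IsW0Limit Ω p w' g') :
    IsW0Limit Ω p (fun x => w x - w' x) (fun x => g x - g' x) := by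
  have hP1 : (1 : ℝ≥0∞) ≤ ENNReal.ofReal p := by simpa using hp
  obtain ⟨ψ, hψ, hw, hg⟩ := h.exists_seq
  obtain ⟨φ, hφ, hw', hg'⟩ := h'.exists_seq
  refine ⟨h.memLp.sub h'.memLp, h.memLp_grad.sub h'.memLp_grad, fun n x => ψ n x - φ n x,
    fun n => (hψ n).sub (hφ n), ?_, ?_⟩
  · refine tendsto_of_tendsto_of_tendsto_of_le_of_le tendsto_const_nhds
      (by simpa using hw.add hw') (fun _ => zero_le) fun n => ?_
    have e : (fun x => w x - w' x - (ψ n x - φ n x)) =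
        (fun x => w x - ψ n x) - fun x => w' x - φ n x := by
      ext x
      simp only [Pi.sub_apply]
      ring
    simp only [e]
    exact eLpNorm_sub_le (h.memLp.1.sub (hψ n).1.continuous.aestronglyMeasurable)
      (h'.memLp.1.sub (hφ n).1.continuous.aestronglyMeasurable) hP1
  · refine tendsto_of_tendsto_of_tendsto_of_le_of_le tendsto_const_nhds
      (by simpa using hg.add hg') (fun _ => zero_le) fun n => ?_
    have e : (fun x => g x - g' x - gradient (fun y => ψ n y - φ n y) x) =
        (fun x => g x - gradient (ψ n) x) - fun x => g' x - gradient (φ n) x := by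
      ext1 x
      have : gradient (fun y => ψ n y - φ n y) x = gradient (ψ n) x - gradient (φ n) x := by
        simp only [gradient]
        rw [fderiv_fun_sub ((hψ n).1.differentiable (by simp) x)
          ((hφ n).1.differentiable (by simp) x), map_sub]
      rw [this, Pi.sub_apply]
      abel
    simp only [e]
    exact eLpNorm_sub_le (h.memLp_grad.1.sub (hψ n).continuous_gradient.aestronglyMeasurable)
      (h'.memLp_grad.1.sub (hφ n).continuous_gradient.aestronglyMeasurable) hP1

lemma IsW0Limit.ae_eq (hΩo : IsOpen Ω) (hΩb : Bornology.IsBounded Ω) (hp : 1 ≤ p)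
    (h : IsW0Limit Ω p w g) (h' : IsW0Limit Ω p w g') : g =ᵐ[volume.restrict Ω] g' :=
  (h.hasWeakGrad hΩb hp).ae_eq hΩo (h'.hasWeakGrad hΩb hp) (EventuallyEq.refl _ _)

lemma truncAt_truncAt {j k : ℝ} (hj : 0 < j) (hjk : j ≤ k) (s : ℝ) :
    truncAt j (truncAt k s) = truncAt j s := by
  unfold truncAt
  rcases max_cases (-k) (min s k) with h | h <;> rcases min_cases s k with h' | h' <;>
  rcases max_cases (-j) (min s j) with h1 | h1 <;> rcases min_cases s j with h2 | h2 <;>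
  rcases max_cases (-j) (min (max (-k) (min s k)) j) with h3 | h3 <;>
  rcases min_cases (max (-k) (min s k)) j with h4 | h4 <;> linarith

lemma abs_truncAt_le_iff {j k : ℝ} (hj : 0 < j) (hjk : j < k) (s : ℝ) :
    |truncAt k s| ≤ j ↔ |s| ≤ j := by
  refine ⟨fun h => ?_, fun h => (abs_truncAt_le_abs (hj.trans hjk).le s).trans h⟩
  by_cases hs : |s| ≤ k
  · rwa [truncAt_of_abs_le hs] at h
  · exfalso
    unfold truncAt at h
    rw [abs_le] at hs h
    rcases max_cases (-k) (min s k) with h1 | h1 <;> rcases min_cases s k with h' | h'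
    · linarith
    · linarith
    · exact hs ⟨by linarith, by linarith⟩
    · linarith

lemma IsW0Limit.truncAt_of_lt (hp : 1 ≤ p) {j k : ℝ} (hj : 0 < j) (hjk : j < k)
    (h : IsW0Limit Ω p (fun x => _root_.truncAt k (u x)) g) :
    IsW0Limit Ω p (fun x => _root_.truncAt j (u x)) ({x | |u x| ≤ j}.indicator g) := by
  have := h.truncAt hp hj
  simpa only [truncAt_truncAt hj hjk.le, abs_truncAt_le_iff hj hjk] using this

/-- By uniqueness of weak gradients, the gradients of T_{n+1}(u) agree a.e. wherever the smaller
truncation is inactive, so they glue to a single field. -/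
lemma exists_isTruncGrad (hΩo : IsOpen Ω) (hΩb : Bornology.IsBounded Ω) (hp : 1 ≤ p)
    (hT : ∀ k : ℝ, 0 < k → MemW0 Ω p (fun x => truncAt k (u x))) :
    ∃ v, AEStronglyMeasurable v (volume.restrict Ω) ∧ ∀ k : ℝ, 0 < k →
      IsW0Limit Ω p (fun x => truncAt k (u x)) ({x | |u x| ≤ k}.indicator v) := by
  choose G hG using fun n : ℕ => (hT (n + 1) (by positivity)).exists_isW0Limit
  have hcoh : ∀ᵐ x ∂(volume.restrict Ω), ∀ m n : ℕ, m < n →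
      G m x = {x | |u x| ≤ m + 1}.indicator (G n) x := by
    simp only [ae_all_iff]
    intro m n hmn
    have : (m : ℝ) + 1 < n + 1 := by
      have : (m : ℝ) < n := by exact_mod_cast hmn
      linarith
    exact (hG m).ae_eq hΩo hΩb hp ((hG n).truncAt_of_lt hp (by positivity) this)
  -- `G n` belongs to level n+1, hence positive even for n = 0; index ⌈|u|⌉ is large enough, as |u|
  -- ≤ ⌈|u|⌉ < ⌈|u|⌉ + 1.
  set v : EuclideanSpace ℝ (Fin N) → EuclideanSpace ℝ (Fin N) := fun x => G ⌈|u x|⌉₊ x with hv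
  have hGv : ∀ᵐ x ∂(volume.restrict Ω), ∀ n : ℕ, ⌈|u x|⌉₊ ≤ n → G n x = v x := by
    filter_upwards [hcoh] with x hx n hn
    rcases hn.eq_or_lt with h | h
    · rw [hv, ← h]
    · simp only [hv]
      rw [hx _ _ h, indicator_of_mem]
      show |u x| ≤ _
      exact (Nat.le_ceil _).trans (by linarith)
  refine ⟨v, ?_, fun k hk => ?_⟩
  · refine aestronglyMeasurable_of_tendsto_ae atTop (fun n => (hG n).memLp_grad.1) ?_
    filter_upwards [hGv] with x hx
    refine tendsto_const_nhds.congr' ?_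
    filter_upwards [eventually_ge_atTop ⌈|u x|⌉₊] with n hn
    exact (hx n hn).symm
  · have hlt : k < (⌈k⌉₊ : ℝ) + 1 := (Nat.le_ceil k).trans_lt (by linarith)
    refine ((hG ⌈k⌉₊).truncAt_of_lt hp hk hlt).congr (EventuallyEq.refl _ _) ?_
    filter_upwards [hGv] with x hx
    by_cases hxk : |u x| ≤ k
    · rw [indicator_of_mem (by exact hxk), indicator_of_mem (by exact hxk)]
      exact hx _ (Nat.ceil_mono hxk)
    · rw [indicator_of_notMem (by exact hxk), indicator_of_notMem (by exact hxk)]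

lemma isTruncGrad_truncGrad (hΩo : IsOpen Ω) (hΩb : Bornology.IsBounded Ω) (hp : 1 ≤ p)
    (hT : ∀ k : ℝ, 0 < k → MemW0 Ω p (fun x => truncAt k (u x))) :
    IsTruncGrad Ω u (truncGrad Ω u) := by
  obtain ⟨v, hvm, hv⟩ := exists_isTruncGrad hΩo hΩb hp hT
  have H : ∃ v, IsTruncGrad Ω u v := ⟨v, hvm, fun k hk => (hv k hk).hasWeakGrad hΩb hp⟩
  rw [truncGrad, dif_pos H]
  exact H.choose_spec

/-- The chosen `truncGrad` agrees a.e. with the glued field on each {|u| ≤ k}, so approximation by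
test functions transfers to it. -/
lemma isW0Limit_truncGrad (hΩo : IsOpen Ω) (hΩb : Bornology.IsBounded Ω) (hp : 1 ≤ p)
    (hT : ∀ k : ℝ, 0 < k → MemW0 Ω p (fun x => truncAt k (u x))) {k : ℝ} (hk : 0 < k) :
    IsW0Limit Ω p (fun x => truncAt k (u x)) ({x | |u x| ≤ k}.indicator (truncGrad Ω u)) := by
  obtain ⟨v, -, hv⟩ := exists_isTruncGrad hΩo hΩb hp hT
  exact (hv k hk).congr (EventuallyEq.refl _ _) (((hv k hk).hasWeakGrad hΩb hp).ae_eq hΩo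
    ((isTruncGrad_truncGrad hΩo hΩb hp hT).2 k hk) (EventuallyEq.refl _ _))

end TruncGrad

/-! ### The energy on one layer. -/

section Entropy

variable {N : ℕ} {Ω : Set (EuclideanSpace ℝ (Fin N))} {p : ℝ}

/-- For φ = T_t(u), this shows that T_t(u - φ) has its gradient concentrated on {t < |u| ≤ 2t}. -/
lemma truncAt_sub_truncAt {t : ℝ} (ht : 0 < t) (s : ℝ) :
    truncAt t (s - truncAt t s) = truncAt (2 * t) s - truncAt t s := by
  unfold truncAt
  rcases max_cases (-t) (min s t) with h1 | h1 <;> rcases min_cases s t with h2 | h2 <;>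
  rcases max_cases (-(2 * t)) (min s (2 * t)) with h3 | h3 <;>
  rcases min_cases s (2 * t) with h4 | h4 <;>
  rcases max_cases (-t) (min (s - max (-t) (min s t)) t) with h5 | h5 <;>
  rcases min_cases (s - max (-t) (min s t)) t with h6 | h6 <;> linarith

/-- The energy of an entropy solution on the layer `{t < u ≤ 2t}`. -/
lemma IsEntropySolution.lintegral_layer_le
    (hΩo : IsOpen Ω) (hΩb : Bornology.IsBounded Ω) (hp1 : 1 < p)
    {a : EuclideanSpace ℝ (Fin N) → ℝ → EuclideanSpace ℝ (Fin N) → EuclideanSpace ℝ (Fin N)}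
    {b : ℝ → ℝ} (hb0 : ∀ s, 0 ≤ b s)
    (hab : ∀ᵐ x ∂(volume.restrict Ω), ∀ (s : ℝ) (ξ : EuclideanSpace ℝ (Fin N)),
      b s * ‖ξ‖ ^ p ≤ inner ℝ (a x s ξ) ξ)
    {h : ℝ≥0 → ℝ≥0∞} {c₂ s₂ γ₂ : ℝ} (hc₂ : 0 < c₂) (hs₂ : 0 < s₂)
    (hh : ∀ s : ℝ≥0, s₂ ≤ (s : ℝ) → h s ≤ ENNReal.ofReal (c₂ / (s : ℝ) ^ γ₂))
    {f u : EuclideanSpace ℝ (Fin N) → ℝ} (hf0 : ∀ᵐ x ∂(volume.restrict Ω), 0 ≤ f x)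
    (hu : IsEntropySolution Ω p a h f u) {t : ℝ} (ht : s₂ ≤ t) :
    ∫⁻ x in Ω, {x | t < u x ∧ u x ≤ 2 * t}.indicator
        (fun x => ENNReal.ofReal (b (u x) * ‖truncGrad Ω u x‖ ^ p)) x
      ≤ ∫⁻ x in Ω, {x | t < u x}.indicator
        (fun x => ENNReal.ofReal (c₂ * t * (f x * u x ^ (-γ₂)))) x := by
  have := isFiniteMeasure_restrict_of_isBounded hΩb
  have ht0 : 0 < t := hs₂.trans_le ht
  set V := truncGrad Ω u with hV
  have hW := fun {k : ℝ} (hk : 0 < k) =>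
    isW0Limit_truncGrad hΩo hΩb hp1.le hu.memW0_trunc hk
  have hφ : MemW0 Ω p (fun x => truncAt t (u x)) := hu.memW0_trunc t ht0
  have hφb : MemLp (fun x => truncAt t (u x)) ⊤ (volume.restrict Ω) :=
    memLp_top_of_bound (hW ht0).memLp.1 t (Eventually.of_forall fun x => abs_truncAt_le ht0.le _)
  have hent := hu.entropy_le t ht0 _ hφ hφb
  have hsrc := (hu.integrable_source t ht0 _ hφ hφb).1
  set D : EuclideanSpace ℝ (Fin N) → EuclideanSpace ℝ (Fin N) := fun x =>
    {x | |u x| ≤ 2 * t}.indicator V x - {x | |u x| ≤ t}.indicator V x with hD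
  have hWD : IsW0Limit Ω p (fun y => truncAt t (u y - truncAt t (u y))) D := by
    simpa only [truncAt_sub_truncAt ht0] using
      (hW (show 0 < 2 * t by positivity)).sub hp1.le (hW ht0)
  have hgradD := (hWD.hasWeakGrad hΩb hp1.le).weakGrad_ae_eq hΩo
  have hgrad2 := ((hW (show 0 < 2 * t by positivity)).hasWeakGrad hΩb hp1.le).weakGrad_ae_eq hΩo
  have hflux := hu.memLp_flux (2 * t) (by positivity)
  -- The flux of T_{2t}(u) is in L^{p/(p-1)} and equals a(x,u,∇u) on the layer. It makes the left
  -- integrand integrable; otherwise its Bochner integral would be 0 by convention and the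
  -- inequality would say nothing.
  set A := fun x => a x (truncAt (2 * t) (u x)) (weakGrad Ω (fun y => truncAt (2 * t) (u y)) x)
    with hA
  have hDval : ∀ᵐ x ∂(volume.restrict Ω), D x = {x | t < u x ∧ u x ≤ 2 * t}.indicator V x := by
    filter_upwards [hu.nonneg] with x hx
    simp only [hD, indicator, mem_ofPred_eq, abs_of_nonneg hx]
    by_cases h1 : u x ≤ t
    · have h2 : u x ≤ 2 * t := by linarith
      simp [h1, h2]
    · have h1' : t < u x := not_le.1 h1
      simp [h1, h1']
  have hI : ∀ᵐ x ∂(volume.restrict Ω), inner ℝ (a x (u x) (V x))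
      (weakGrad Ω (fun y => truncAt t (u y - truncAt t (u y))) x) = inner ℝ (A x) (D x) := by
    filter_upwards [hgradD, hgrad2, hDval, hu.nonneg] with x h1 h2 h3 h4
    rw [h1, h3]
    by_cases hx : t < u x ∧ u x ≤ 2 * t
    · have hx2 : |u x| ≤ 2 * t := by rw [abs_of_nonneg h4]; exact hx.2
      simp only [hA]
      rw [h2, truncAt_of_abs_le hx2, indicator_of_mem (by exact hx), indicator_of_mem (by exact hx2)]
    · rw [indicator_of_notMem (by exact hx), inner_zero_right, inner_zero_right]
  rw [integral_congr_ae hI] at hent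
  have hconj : (ENNReal.ofReal (p / (p - 1))).HolderConjugate (ENNReal.ofReal p) := by
    have : p.HolderConjugate (p / (p - 1)) := Real.HolderConjugate.conjExponent hp1
    exact this.symm.ennrealOfReal
  have hAD : Integrable (fun x => inner ℝ (A x) (D x)) (volume.restrict Ω) := by
    refine Integrable.mono (hflux.norm.integrable_mul hWD.memLp_grad.norm)
      (hflux.1.inner hWD.memLp_grad.1) (Eventually.of_forall fun x => ?_)
    refine (norm_inner_le_norm _ _).trans ?_
    simp only [Pi.mul_apply]
    exact le_abs_self _
  have hlow : ∀ᵐ x ∂(volume.restrict Ω), {x | t < u x ∧ u x ≤ 2 * t}.indicator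
      (fun x => b (u x) * ‖V x‖ ^ p) x ≤ inner ℝ (A x) (D x) := by
    filter_upwards [hI, hgradD, hDval, hab] with x h1 h2 h3 h4
    rw [← h1, h2, h3]
    by_cases hx : t < u x ∧ u x ≤ 2 * t
    · rw [indicator_of_mem (by exact hx), indicator_of_mem (by exact hx)]
      exact h4 _ _
    · rw [indicator_of_notMem (by exact hx), indicator_of_notMem (by exact hx), inner_zero_right]
  have hnn : ∀ x, 0 ≤ {x | t < u x ∧ u x ≤ 2 * t}.indicator
      (fun x => b (u x) * ‖V x‖ ^ p) x := fun x =>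
    indicator_nonneg (fun x _ => mul_nonneg (hb0 _) (by positivity)) x
  have hTval : ∀ᵐ x ∂(volume.restrict Ω), 0 ≤ truncAt t (u x - truncAt t (u x)) ∧
      truncAt t (u x - truncAt t (u x)) ≤ {x | t < u x}.indicator (fun _ => t) x := by
    filter_upwards [hu.nonneg] with x hx
    have hb' := abs_le.1 (abs_truncAt_le ht0.le (u x - truncAt t (u x)))
    by_cases h1 : t < u x
    · rw [indicator_of_mem (by exact h1)]
      refine ⟨?_, hb'.2⟩
      have := (abs_le.1 (abs_truncAt_le ht0.le (u x))).2
      exact le_max_of_le_right (le_min (by linarith) ht0.le)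
    · have : truncAt t (u x) = u x := truncAt_of_abs_le (by
        rw [abs_of_nonneg hx]; exact not_lt.1 h1)
      rw [indicator_of_notMem (by exact h1), this, sub_self, truncAt_of_abs_le (by simpa using ht0.le)]
      simp
  have hJ0 : 0 ≤ᵐ[volume.restrict Ω] fun x =>
      (sourceTerm h f u x).toReal * truncAt t (u x - truncAt t (u x)) := by
    filter_upwards [hTval] with x hx using mul_nonneg ENNReal.toReal_nonneg hx.1
  have hJm : AEStronglyMeasurable (fun x =>
      (sourceTerm h f u x).toReal * truncAt t (u x - truncAt t (u x))) (volume.restrict Ω) :=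
    hsrc.ennreal_toReal.aestronglyMeasurable.mul hWD.memLp.1
  calc ∫⁻ x in Ω, {x | t < u x ∧ u x ≤ 2 * t}.indicator
        (fun x => ENNReal.ofReal (b (u x) * ‖V x‖ ^ p)) x
      = ∫⁻ x in Ω, ENNReal.ofReal ({x | t < u x ∧ u x ≤ 2 * t}.indicator
        (fun x => b (u x) * ‖V x‖ ^ p) x) := by
        refine lintegral_congr fun x => ?_
        by_cases hx : t < u x ∧ u x ≤ 2 * t
        · rw [indicator_of_mem (by exact hx), indicator_of_mem (by exact hx)]
        · rw [indicator_of_notMem (by exact hx), indicator_of_notMem (by exact hx),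
            ENNReal.ofReal_zero]
    _ ≤ ∫⁻ x in Ω, ENNReal.ofReal (inner ℝ (A x) (D x)) := by
        refine lintegral_mono_ae ?_
        filter_upwards [hlow] with x hx using ENNReal.ofReal_le_ofReal hx
    _ = ENNReal.ofReal (∫ x in Ω, inner ℝ (A x) (D x)) := by
        rw [ofReal_integral_eq_lintegral_ofReal hAD]
        filter_upwards [hlow] with x hx using (hnn x).trans hx
    _ ≤ ENNReal.ofReal (∫ x in Ω,
          (sourceTerm h f u x).toReal * truncAt t (u x - truncAt t (u x))) :=
        ENNReal.ofReal_le_ofReal hent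
    -- The source integrand is nonnegative, so its Bochner integral is the `toReal` of the lower
    -- integral; this bound holds even if the latter is infinite.
    _ ≤ ∫⁻ x in Ω, ENNReal.ofReal
          ((sourceTerm h f u x).toReal * truncAt t (u x - truncAt t (u x))) := by
        rw [integral_eq_lintegral_of_nonneg_ae hJ0 hJm]
        exact ENNReal.ofReal_toReal_le
    _ ≤ ∫⁻ x in Ω, {x | t < u x}.indicator
        (fun x => ENNReal.ofReal (c₂ * t * (f x * u x ^ (-γ₂)))) x := by
        refine lintegral_mono_ae ?_
        filter_upwards [hTval, hf0] with x hx hfx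
        by_cases h1 : t < u x
        · rw [indicator_of_mem (by exact h1)] at hx ⊢
          refine ENNReal.ofReal_le_ofReal ?_
          have hu0 : 0 < u x := ht0.trans h1
          have hsl : sourceTerm h f u x ≤ ENNReal.ofReal (c₂ / u x ^ γ₂ * f x) := by
            unfold sourceTerm
            rw [ENNReal.ofReal_mul (by positivity)]
            gcongr
            have := hh (u x).toNNReal (by rw [Real.coe_toNNReal _ hu0.le]; linarith)
            rwa [Real.coe_toNNReal _ hu0.le] at this
          have hsl' : (sourceTerm h f u x).toReal ≤ c₂ / u x ^ γ₂ * f x :=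
            ENNReal.toReal_le_of_le_ofReal (by positivity) hsl
          calc _ ≤ (c₂ / u x ^ γ₂ * f x) * t :=
                mul_le_mul hsl' hx.2 hx.1 (by positivity)
            _ = _ := by
                rw [Real.rpow_neg hu0.le]
                ring
        · rw [indicator_of_notMem (by exact h1)] at hx ⊢
          have : truncAt t (u x - truncAt t (u x)) = 0 := le_antisymm hx.2 hx.1
          simp [this]

end Entropy

/-! ### A smooth substitute for 1 + |s|. -/

section Bracket

/-- The Japanese bracket `⟨s⟩ = (1 + s²)^{1/2}`. -/
noncomputable def bracket (s : ℝ) : ℝ := Real.sqrt (1 + s ^ 2)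

lemma one_le_bracket (s : ℝ) : 1 ≤ bracket s :=
  Real.one_le_sqrt.2 (by nlinarith [sq_nonneg s])

lemma bracket_pos (s : ℝ) : 0 < bracket s := zero_lt_one.trans_le (one_le_bracket s)

lemma abs_le_bracket (s : ℝ) : |s| ≤ bracket s :=
  Real.abs_le_sqrt (by linarith)

lemma bracket_le_one_add_abs (s : ℝ) : bracket s ≤ 1 + |s| := by
  refine (Real.sqrt_le_left (by positivity)).2 ?_
  nlinarith [sq_abs s, abs_nonneg s]

lemma one_add_abs_le_two_mul_bracket (s : ℝ) : 1 + |s| ≤ 2 * bracket s := by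
  linarith [abs_le_bracket s, one_le_bracket s]

lemma continuous_bracket : Continuous bracket := by
  unfold bracket
  fun_prop

lemma continuous_bracket_rpow (e : ℝ) : Continuous fun s => bracket s ^ e :=
  continuous_bracket.rpow_const fun s => Or.inl (bracket_pos s).ne'

/-- The bracket is smooth and at least 1, so even small powers have no singularity at 0, and the
smooth chain rule suffices. -/
lemma contDiff_bracket_rpow (β : ℝ) : ContDiff ℝ ∞ fun s => bracket s ^ β := by
  have h : ContDiff ℝ ∞ bracket := by
    unfold bracket
    exact (contDiff_const.add (contDiff_id.pow 2)).sqrt fun s => by positivity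
  exact h.rpow_const_of_ne fun s => (bracket_pos s).ne'

lemma norm_deriv_bracket_rpow_le {β : ℝ} (hβ : 0 ≤ β) (s : ℝ) :
    ‖deriv (fun s => bracket s ^ β - 1) s‖ ≤ β * bracket s ^ (β - 1) := by
  have h1 : HasDerivAt bracket (s / bracket s) s := by
    have h2 : HasDerivAt (fun s : ℝ => 1 + s ^ 2) (2 * s) s := by
      simpa using (hasDerivAt_pow 2 s).const_add 1
    have h3 := h2.sqrt (by positivity)
    rw [mul_div_mul_left _ _ two_ne_zero] at h3
    exact h3
  have h2 := ((h1.rpow_const (p := β) (Or.inl (bracket_pos s).ne')).sub_const 1).deriv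
  rw [h2, norm_mul, norm_mul, Real.norm_of_nonneg hβ,
    Real.norm_of_nonneg (Real.rpow_nonneg (bracket_pos s).le _), norm_div,
    Real.norm_of_nonneg (bracket_pos s).le, mul_assoc]
  refine mul_le_of_le_one_left (by have := bracket_pos s; positivity) ?_
  exact div_le_one_of_le₀ (abs_le_bracket s) (bracket_pos s).le

/-- One bound for exponents of either sign. -/
lemma Real.rpow_le_rpow_abs_exponent {x M e : ℝ} (hx : 1 ≤ x) (hM : x ≤ M) : x ^ e ≤ M ^ |e| :=
  (Real.rpow_le_rpow_of_exponent_le hx (le_abs_self e)).trans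
    (Real.rpow_le_rpow (by linarith) hM (abs_nonneg e))

end Bracket

/-! ### Dyadic summation of the layer estimates. -/

section Dyadic

/-- Dyadic geometric sums of `t_i ^ η` over the levels `t_i = 2 ^ i * s` below `r`. -/
lemma sum_dyadic_rpow_le {s η : ℝ} (hs : 0 < s) (hη : 0 < η) {r : ℝ} (hr : 0 ≤ r) (j : ℕ) :
    ∑ i ∈ Finset.range j, (if 2 ^ i * s < r then (2 ^ i * s) ^ η else 0) ≤
      (2 ^ η - 1)⁻¹ * (min (2 * r) (2 ^ j * s)) ^ η := by
  have hA : 0 < (2 : ℝ) ^ η - 1 := sub_pos.2 (Real.one_lt_rpow one_lt_two hη)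
  -- With t = 2^j s, the step below r is the identity t^η/(2^η-1) + t^η = (2t)^η/(2^η-1); above r
  -- nothing is added.
  induction j with
  | zero =>
    simp only [Finset.range_zero, Finset.sum_empty]
    positivity
  | succ j ih =>
    rw [Finset.sum_range_succ]
    have ht : 0 < 2 ^ j * s := by positivity
    have h2 : (2 : ℝ) ^ (j + 1) * s = 2 * (2 ^ j * s) := by ring
    rw [h2]
    set t := 2 ^ j * s with ht'
    by_cases h : t < r
    · rw [if_pos h, min_eq_right (by linarith), Real.mul_rpow (by norm_num) ht.le]
      rw [min_eq_right (by linarith)] at ih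
      refine (add_le_add ih le_rfl).trans (le_of_eq ?_)
      field_simp
      ring
    · rw [if_neg h, add_zero]
      refine ih.trans ?_
      gcongr
      linarith

variable {X : Type*} [MeasurableSpace X] {μ : Measure X}

/-- From layer estimates to weighted energy estimates. -/
lemma exists_weighted_energy_le {u w f : X → ℝ} (hu : AEMeasurable u μ) (hw : AEMeasurable w μ)
    (hw0 : ∀ x, 0 ≤ w x) (hf : AEMeasurable f μ) {b : ℝ → ℝ}
    {α τ c s γ η : ℝ} (hα : 0 < α) (hτ : 0 ≤ τ) (hb : ∀ r, α / (1 + |r|) ^ τ ≤ b r)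
    (hc : 0 ≤ c) (hs : 0 < s) (hη : 0 < η)
    (hlayer : ∀ t, s ≤ t → ∫⁻ x, {x | t < u x ∧ u x ≤ 2 * t}.indicator
        (fun x => ENNReal.ofReal (b (u x) * w x)) x ∂μ
      ≤ ∫⁻ x, {x | t < u x}.indicator
        (fun x => ENNReal.ofReal (c * t * (f x * u x ^ (-γ)))) x ∂μ) :
    ∃ C : ℝ, ∀ j : ℕ, ∫⁻ x, {x | s < u x ∧ u x ≤ 2 ^ j * s}.indicator
        (fun x => ENNReal.ofReal (bracket (u x) ^ (η - 1 - τ) * w x)) x ∂μ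
      ≤ ENNReal.ofReal C * ∫⁻ x, {x | s < u x}.indicator
        (fun x => ENNReal.ofReal (f x * u x ^ (-γ) * min (u x) (2 ^ j * s) ^ η)) x ∂μ := by
  -- For s ≤ t < r ≤ 2t one has ⟨r⟩ ≤ 1 + 2t ≤ M t. In `C₁`, the absolute value covers both signs of
  -- η-1, and 2^τ/α comes from 1 + |r| ≤ 2⟨r⟩ and the lower bound on b.
  set M : ℝ := 1 / s + 2 with hM
  set C₁ : ℝ := M ^ |η - 1| * 2 ^ τ / α with hC₁
  have hC₁0 : 0 ≤ C₁ := by positivity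
  have hA : 0 < (2 : ℝ) ^ η - 1 := sub_pos.2 (Real.one_lt_rpow one_lt_two hη)
  have hpt : ∀ t r, s ≤ t → t < r → r ≤ 2 * t →
      bracket r ^ (η - 1 - τ) ≤ C₁ * t ^ (η - 1) * b r := by
    intro t r hst htr hrt
    have ht : 0 < t := hs.trans_le hst
    have hr : 0 < r := ht.trans htr
    have hB := bracket_pos r
    have h1 : bracket r ^ (η - 1) ≤ M ^ |η - 1| * t ^ (η - 1) := by
      have e : bracket r = bracket r / t * t := by field_simp
      have hbr : t ≤ bracket r := htr.le.trans ((le_abs_self r).trans (abs_le_bracket r))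
      have hle : bracket r / t ≤ M := by
        rw [div_le_iff₀ ht, hM, add_mul]
        have h1 : 1 ≤ 1 / s * t := by rw [one_div, ← div_eq_inv_mul]; exact (one_le_div hs).2 hst
        have := bracket_le_one_add_abs r
        rw [abs_of_pos hr] at this
        linarith
      calc bracket r ^ (η - 1) = (bracket r / t) ^ (η - 1) * t ^ (η - 1) := by
            rw [← Real.mul_rpow (by positivity) ht.le, ← e]
        _ ≤ _ := by
            gcongr
            exact Real.rpow_le_rpow_abs_exponent ((one_le_div ht).2 hbr) hle
    have h2 : bracket r ^ (-τ) ≤ 2 ^ τ / α * b r := by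
      have h3 : α / (2 * bracket r) ^ τ ≤ b r := by
        refine le_trans ?_ (hb r)
        gcongr
        exact one_add_abs_le_two_mul_bracket r
      calc bracket r ^ (-τ) = 2 ^ τ / α * (α / (2 * bracket r) ^ τ) := by
            rw [Real.rpow_neg hB.le, Real.mul_rpow (by norm_num) hB.le]
            field_simp
        _ ≤ _ := by gcongr
    calc bracket r ^ (η - 1 - τ) = bracket r ^ (η - 1) * bracket r ^ (-τ) := by
          rw [← Real.rpow_add hB]; rfl
      _ ≤ (M ^ |η - 1| * t ^ (η - 1)) * (2 ^ τ / α * b r) := by gcongr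
      _ = _ := by rw [hC₁]; ring
  have hum : ∀ t : ℝ, NullMeasurableSet {x | t < u x} μ := fun t =>
    nullMeasurableSet_lt aemeasurable_const hu
  have hum' : ∀ t : ℝ, NullMeasurableSet {x | u x ≤ t} μ := fun t =>
    nullMeasurableSet_le hu aemeasurable_const
  have hWm : AEMeasurable (fun x => ENNReal.ofReal (bracket (u x) ^ (η - 1 - τ) * w x)) μ :=
    (((continuous_bracket_rpow _).measurable.comp_aemeasurable hu).mul hw).ennreal_ofReal
  have hGm : AEMeasurable (fun x => ENNReal.ofReal (f x * u x ^ (-γ))) μ :=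
    (hf.mul (hu.pow_const _)).ennreal_ofReal
  set G : X → ℝ≥0∞ := fun x => ENNReal.ofReal (f x * u x ^ (-γ)) with hG
  set W : X → ℝ≥0∞ := fun x => ENNReal.ofReal (bracket (u x) ^ (η - 1 - τ) * w x) with hW
  have hlay : ∀ t, s ≤ t → ∫⁻ x, {x | t < u x ∧ u x ≤ 2 * t}.indicator W x ∂μ ≤
      ∫⁻ x, {x | t < u x}.indicator (fun x => ENNReal.ofReal (C₁ * c * t ^ η) * G x) x ∂μ := by
    intro t hst
    have ht : 0 < t := hs.trans_le hst
    calc ∫⁻ x, {x | t < u x ∧ u x ≤ 2 * t}.indicator W x ∂μ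
        ≤ ∫⁻ x, ENNReal.ofReal (C₁ * t ^ (η - 1)) * {x | t < u x ∧ u x ≤ 2 * t}.indicator
            (fun x => ENNReal.ofReal (b (u x) * w x)) x ∂μ := by
          refine lintegral_mono fun x => ?_
          by_cases hx : t < u x ∧ u x ≤ 2 * t
          · rw [indicator_of_mem (by exact hx), indicator_of_mem (by exact hx),
              ← ENNReal.ofReal_mul (by positivity), ← mul_assoc]
            exact ENNReal.ofReal_le_ofReal
              (mul_le_mul_of_nonneg_right (hpt t _ hst hx.1 hx.2) (hw0 x))
          · rw [indicator_of_notMem (by exact hx)]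
            exact zero_le
      _ = ENNReal.ofReal (C₁ * t ^ (η - 1)) * ∫⁻ x, {x | t < u x ∧ u x ≤ 2 * t}.indicator
            (fun x => ENNReal.ofReal (b (u x) * w x)) x ∂μ :=
          lintegral_const_mul' _ _ ENNReal.ofReal_ne_top
      _ ≤ ENNReal.ofReal (C₁ * t ^ (η - 1)) * ∫⁻ x, {x | t < u x}.indicator
            (fun x => ENNReal.ofReal (c * t * (f x * u x ^ (-γ)))) x ∂μ := by
          exact mul_le_mul_right (hlayer t hst) _
      _ = _ := by
          rw [← lintegral_const_mul' _ _ ENNReal.ofReal_ne_top]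
          refine lintegral_congr fun x => ?_
          by_cases hx : t < u x
          · rw [indicator_of_mem (by exact hx), indicator_of_mem (by exact hx), hG,
              ENNReal.ofReal_mul (p := c * t) (by positivity), ← mul_assoc,
              ← ENNReal.ofReal_mul (by positivity)]
            congr 2
            have : t ^ η = t ^ (η - 1) * t := by
              rw [← Real.rpow_add_one ht.ne', sub_add_cancel]
            rw [this]
            ring
          · rw [indicator_of_notMem (by exact hx), indicator_of_notMem (by exact hx), mul_zero]
  -- (2^η-1)⁻¹ comes from the geometric sum, 2^η from min(2r, T) ≤ 2 min(r, T). The cap T = 2^j s is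
  -- kept so that the right side involves only a truncation of u.
  refine ⟨C₁ * c * ((2 ^ η - 1)⁻¹ * 2 ^ η), fun j => ?_⟩
  calc ∫⁻ x, {x | s < u x ∧ u x ≤ 2 ^ j * s}.indicator W x ∂μ
      ≤ ∫⁻ x, ∑ i ∈ Finset.range j,
          {x | 2 ^ i * s < u x ∧ u x ≤ 2 * (2 ^ i * s)}.indicator W x ∂μ := by
        refine lintegral_mono fun x => ?_
        induction j with
        | zero =>
          rw [indicator_of_notMem]
          · exact zero_le
          · intro h
            have h' : s < u x ∧ u x ≤ 2 ^ 0 * s := h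
            linarith [h'.1, h'.2]
        | succ j ih =>
          rw [Finset.sum_range_succ]
          by_cases hx : s < u x ∧ u x ≤ 2 ^ (j + 1) * s
          · rw [indicator_of_mem (by exact hx)]
            by_cases hx' : u x ≤ 2 ^ j * s
            · refine le_trans ?_ (ih.trans le_self_add)
              rw [indicator_of_mem (by exact ⟨hx.1, hx'⟩)]
            · refine le_trans ?_ le_add_self
              rw [indicator_of_mem (by
                exact ⟨not_le.1 hx', hx.2.trans_eq (by ring)⟩)]
          · rw [indicator_of_notMem (by exact hx)]
            exact zero_le
    _ = ∑ i ∈ Finset.range j, ∫⁻ x,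
          {x | 2 ^ i * s < u x ∧ u x ≤ 2 * (2 ^ i * s)}.indicator W x ∂μ :=
        lintegral_finsetSum' _ fun i _ => hWm.indicator₀ ((hum _).inter (hum' _))
    _ ≤ ∑ i ∈ Finset.range j, ∫⁻ x, {x | 2 ^ i * s < u x}.indicator
          (fun x => ENNReal.ofReal (C₁ * c * (2 ^ i * s) ^ η) * G x) x ∂μ := by
        refine Finset.sum_le_sum fun i _ => ?_
        refine hlay _ (le_mul_of_one_le_left hs.le (one_le_pow₀ one_le_two))
    _ = ∫⁻ x, ∑ i ∈ Finset.range j, {x | 2 ^ i * s < u x}.indicator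
          (fun x => ENNReal.ofReal (C₁ * c * (2 ^ i * s) ^ η) * G x) x ∂μ :=
        (lintegral_finsetSum' _ fun i _ => (hGm.const_mul _).indicator₀ (hum _)).symm
    _ ≤ ∫⁻ x, ENNReal.ofReal (C₁ * c * ((2 ^ η - 1)⁻¹ * 2 ^ η)) * {x | s < u x}.indicator
        (fun x => ENNReal.ofReal (f x * u x ^ (-γ) * min (u x) (2 ^ j * s) ^ η)) x ∂μ := by
        refine lintegral_mono fun x => ?_
        have hsum : ∀ i ∈ Finset.range j, {x | 2 ^ i * s < u x}.indicator
            (fun x => ENNReal.ofReal (C₁ * c * (2 ^ i * s) ^ η) * G x) x =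
            ENNReal.ofReal (C₁ * c * if 2 ^ i * s < u x then (2 ^ i * s) ^ η else 0) * G x := by
          intro i _
          by_cases hx : 2 ^ i * s < u x
          · rw [indicator_of_mem (by exact hx), if_pos hx]
          · rw [indicator_of_notMem (by exact hx), if_neg hx]
            simp
        rw [Finset.sum_congr rfl hsum, ← Finset.sum_mul, ← ENNReal.ofReal_sum_of_nonneg
          (fun i _ => by split_ifs <;> positivity), ← Finset.mul_sum]
        by_cases hx : s < u x
        · have hux : 0 < u x := hs.trans hx
          have hm : 0 ≤ min (u x) (2 ^ j * s) := le_min hux.le (by positivity)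
          rw [indicator_of_mem (by exact hx), ENNReal.ofReal_mul' (p := f x * u x ^ (-γ)) (by positivity),
            mul_comm (ENNReal.ofReal (f x * u x ^ (-γ))), ← mul_assoc,
            ← ENNReal.ofReal_mul (p := C₁ * c * ((2 ^ η - 1)⁻¹ * 2 ^ η)) (by positivity)]
          refine mul_le_mul' (ENNReal.ofReal_le_ofReal ?_) le_rfl
          rw [mul_assoc (C₁ * c)]
          refine mul_le_mul_of_nonneg_left ?_ (by positivity)
          refine (sum_dyadic_rpow_le hs hη hux.le j).trans ?_
          rw [mul_assoc]
          gcongr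
          rw [← Real.mul_rpow (by norm_num) hm]
          have h0 : (0 : ℝ) ≤ 2 ^ j * s := by positivity
          gcongr
          rw [mul_min_of_nonneg _ _ (by norm_num)]
          exact min_le_min le_rfl (by linarith)
        · rw [indicator_of_notMem (by exact hx), mul_zero]
          have : ∑ i ∈ Finset.range j, (if 2 ^ i * s < u x then (2 ^ i * s) ^ η else 0) = 0 := by
            refine Finset.sum_eq_zero fun i _ => if_neg ?_
            have : s ≤ 2 ^ i * s := le_mul_of_one_le_left hs.le (one_le_pow₀ one_le_two)
            linarith
          rw [this]
          simp
    _ = _ := lintegral_const_mul' _ _ ENNReal.ofReal_ne_top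

end Dyadic

/-! ### Absorption and passage to the limit. -/

section Absorption

/-- For x ≥ 1 the right side is at most 2C x^τ, and x^τ can be cancelled because x is finite. For x
= ∞ the hypothesis is no constraint, hence the use on truncations only. -/
lemma ENNReal.le_max_of_rpow_le_mul_one_add_rpow {x C : ℝ≥0∞} {a τ : ℝ} (hτ : 0 ≤ τ)
    (hτa : τ < a) (hx : x ≠ ⊤) (h : x ^ a ≤ C * (1 + x ^ τ)) :
    x ≤ max 1 ((2 * C) ^ (1 / (a - τ))) := by
  rcases le_total x 1 with h1 | h1
  · exact le_max_of_le_left h1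
  · refine le_max_of_le_right ?_
    have hx0 : x ≠ 0 := (zero_lt_one.trans_le h1).ne'
    have h2 : 1 ≤ x ^ τ := by
      simpa using ENNReal.rpow_le_rpow h1 hτ
    have h3 : x ^ (a - τ) * x ^ τ ≤ 2 * C * x ^ τ := by
      rw [← ENNReal.rpow_add _ _ hx0 hx, sub_add_cancel]
      calc x ^ a ≤ C * (1 + x ^ τ) := h
        _ ≤ C * (x ^ τ + x ^ τ) := by gcongr
        _ = _ := by ring
    have h4 : x ^ (a - τ) ≤ 2 * C :=
      (ENNReal.mul_le_mul_iff_left (zero_lt_one.trans_le h2).ne'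
        (ENNReal.rpow_ne_top_of_nonneg hτ hx)).1 h3
    rw [one_div]
    exact (ENNReal.le_rpow_inv_iff (sub_pos.2 hτa)).2 h4

variable {X : Type*} [MeasurableSpace X] {μ : Measure X}

/-- Fatou, in the form used to let the truncation level tend to infinity. -/
lemma lintegral_le_of_eventually_eq {F : ℕ → X → ℝ≥0∞} {G : X → ℝ≥0∞} {M : ℝ≥0∞}
    (hF : ∀ n, AEMeasurable (F n) μ) (h : ∀ x, ∀ᶠ n in atTop, F n x = G x)
    (hM : ∀ n, ∫⁻ x, F n x ∂μ ≤ M) : ∫⁻ x, G x ∂μ ≤ M := by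
  have : ∀ x, liminf (fun n => F n x) atTop = G x := fun x =>
    (tendsto_const_nhds.congr' ((h x).mono fun _ hn => hn.symm)).liminf_eq
  calc ∫⁻ x, G x ∂μ = ∫⁻ x, liminf (fun n => F n x) atTop ∂μ := by simp only [this]
    _ ≤ liminf (fun n => ∫⁻ x, F n x ∂μ) atTop := lintegral_liminf_le' hF
    _ ≤ M := by
      refine (liminf_le_liminf (Eventually.of_forall hM)).trans ?_
      simp

lemma eLpNorm_ofReal_rpow_eq {E : Type*} [NormedAddCommGroup E] {q : ℝ} (hq : 0 < q) (f : X → E) :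
    eLpNorm f (ENNReal.ofReal q) μ = (∫⁻ x, ENNReal.ofReal (‖f x‖ ^ q) ∂μ) ^ (1 / q) := by
  rw [eLpNorm_eq_lintegral_rpow_enorm_toReal (by simpa using hq) ENNReal.ofReal_ne_top,
    ENNReal.toReal_ofReal hq.le]
  congr 1
  refine lintegral_congr fun x => ?_
  rw [← ofReal_norm, ENNReal.ofReal_rpow_of_nonneg (norm_nonneg _) hq.le]

end Absorption

/-! ### Sobolev bootstrap for powers of the bracket. -/

section APriori

variable {N : ℕ} {Ω : Set (EuclideanSpace ℝ (Fin N))} {p : ℝ}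
  {u : EuclideanSpace ℝ (Fin N) → ℝ}
  {v : EuclideanSpace ℝ (Fin N) → EuclideanSpace ℝ (Fin N)}

lemma sobolevConj_pos (hp : 0 < p) (hpN : p < N) : 0 < sobolevConj N p := by
  unfold sobolevConj
  have : 0 < N - p := by linarith
  have : (0 : ℝ) < N := by linarith
  positivity

/-- Sobolev's inequality for powers of the bracket of the truncations. -/
lemma exists_bracket_sobolev (hΩb : Bornology.IsBounded Ω) (hp : 1 ≤ p) (hpN : p < N)
    {β : ℝ} (hβ : 0 < β)
    (hW : ∀ k : ℝ, 0 < k → IsW0Limit Ω p (fun x => truncAt k (u x)) ({x | |u x| ≤ k}.indicator v)) :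
    ∃ C : ℝ≥0∞, C ≠ ⊤ ∧ ∀ k : ℝ, 0 < k →
      (∫⁻ x in Ω, ENNReal.ofReal (bracket (truncAt k (u x)) ^ (β * sobolevConj N p))) ^
        (p / sobolevConj N p) ≤
      C * (1 + ∫⁻ x in Ω, {x | |u x| ≤ k}.indicator
        (fun x => ENNReal.ofReal (bracket (u x) ^ ((β - 1) * p) * ‖v x‖ ^ p)) x) := by
  have := isFiniteMeasure_restrict_of_isBounded hΩb
  have hp0 : 0 < p := by linarith
  have hq := sobolevConj_pos hp0 hpN
  have hq1 : 1 ≤ sobolevConj N p := by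
    unfold sobolevConj
    rw [one_le_div (by linarith)]
    have : (N : ℝ) ≤ N * p := le_mul_of_one_le_right (by linarith) hp
    linarith
  set q := sobolevConj N p with hqdef
  obtain ⟨Cs, hCs⟩ := exists_sobolev_const Ω hp hpN
  set S := eLpNorm (fun _ : EuclideanSpace ℝ (Fin N) => (1 : ℝ)) (ENNReal.ofReal q)
    (volume.restrict Ω) with hS
  have hSt : S ≠ ⊤ := (memLp_const (1 : ℝ)).2.ne
  set A : ℝ≥0∞ := (Cs : ℝ≥0∞) ^ p * ENNReal.ofReal (β ^ p) with hA
  refine ⟨2 ^ (p - 1) * (A + S ^ p), ?_, fun k hk => ?_⟩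
  · refine ENNReal.mul_ne_top (ENNReal.rpow_ne_top_of_nonneg (by linarith) (by simp)) ?_
    refine ENNReal.add_ne_top.2 ⟨ENNReal.mul_ne_top ?_ ENNReal.ofReal_ne_top, ?_⟩
    · exact ENNReal.rpow_ne_top_of_nonneg hp0.le ENNReal.coe_ne_top
    · exact ENNReal.rpow_ne_top_of_nonneg hp0.le hSt
  set D := ∫⁻ x in Ω, {x | |u x| ≤ k}.indicator
        (fun x => ENNReal.ofReal (bracket (u x) ^ ((β - 1) * p) * ‖v x‖ ^ p)) x with hD
  set Y := ∫⁻ x in Ω, ENNReal.ofReal (bracket (truncAt k (u x)) ^ (β * q)) with hY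
  -- Subtracting 1 makes the function vanish at 0, as W^{1,p}_0 demands; the constant is restored by
  -- the triangle inequality, at the cost of `S`, finite since Ω is bounded.
  have hcomp := (hW k hk).comp_of_bounded hp (F := fun s => bracket s ^ β - 1)
    ((contDiff_bracket_rpow β).sub contDiff_const) (by simp [bracket]) hk
    (Eventually.of_forall fun x => abs_truncAt_le hk.le _)
  have hsob := hCs _ _ hcomp
  have hgrad : eLpNorm (fun x => deriv (fun s => bracket s ^ β - 1) (truncAt k (u x)) •
      {x | |u x| ≤ k}.indicator v x) (ENNReal.ofReal p) (volume.restrict Ω) ≤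
      (ENNReal.ofReal (β ^ p) * D) ^ (1 / p) := by
    rw [eLpNorm_ofReal_rpow_eq hp0, hD, ← lintegral_const_mul' _ _ ENNReal.ofReal_ne_top]
    refine ENNReal.rpow_le_rpow (lintegral_mono fun x => ?_) (by positivity)
    by_cases hx : |u x| ≤ k
    · rw [indicator_of_mem (by exact hx), indicator_of_mem (by exact hx), truncAt_of_abs_le hx,
        ← ENNReal.ofReal_mul (by positivity), norm_smul]
      refine ENNReal.ofReal_le_ofReal ?_
      have hB := bracket_pos (u x)
      calc (‖deriv (fun s => bracket s ^ β - 1) (u x)‖ * ‖v x‖) ^ p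
          ≤ ((β * bracket (u x) ^ (β - 1)) * ‖v x‖) ^ p := by
            gcongr
            exact norm_deriv_bracket_rpow_le hβ.le _
        _ = _ := by
            rw [Real.mul_rpow (by positivity) (by positivity),
              Real.mul_rpow (by positivity) (by positivity), ← Real.rpow_mul hB.le]
            ring
    · rw [indicator_of_notMem (by exact hx), smul_zero, norm_zero, Real.zero_rpow hp0.ne',
        ENNReal.ofReal_zero]
      exact zero_le
  have hYe : Y ^ (1 / q) = eLpNorm (fun x => bracket (truncAt k (u x)) ^ β) (ENNReal.ofReal q)
      (volume.restrict Ω) := by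
    rw [eLpNorm_ofReal_rpow_eq hq, hY]
    congr 1
    refine lintegral_congr fun x => ?_
    have hB := bracket_pos (truncAt k (u x))
    rw [Real.norm_of_nonneg (by positivity), Real.rpow_mul hB.le]
  have htri : Y ^ (1 / q) ≤ Cs * (ENNReal.ofReal (β ^ p) * D) ^ (1 / p) + S := by
    rw [hYe]
    have e : (fun x => bracket (truncAt k (u x)) ^ β) =
        (fun x => bracket (truncAt k (u x)) ^ β - 1) + fun _ => (1 : ℝ) := by
      ext x
      simp
    rw [e]
    refine (eLpNorm_add_le hcomp.memLp.1 aestronglyMeasurable_const (by simpa using hq1)).trans ?_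
    exact add_le_add (hsob.trans (mul_le_mul' le_rfl hgrad)) le_rfl
  calc Y ^ (p / q) = (Y ^ (1 / q)) ^ p := by
        rw [← ENNReal.rpow_mul]
        congr 1
        ring
    _ ≤ (Cs * (ENNReal.ofReal (β ^ p) * D) ^ (1 / p) + S) ^ p :=
        ENNReal.rpow_le_rpow htri hp0.le
    _ ≤ 2 ^ (p - 1) * ((Cs * (ENNReal.ofReal (β ^ p) * D) ^ (1 / p)) ^ p + S ^ p) :=
        ENNReal.rpow_add_le_mul_rpow_add_rpow _ _ hp
    _ = 2 ^ (p - 1) * (A * D + S ^ p) := by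
        rw [ENNReal.mul_rpow_of_nonneg _ _ hp0.le, ← ENNReal.rpow_mul, one_div,
          inv_mul_cancel₀ hp0.ne', ENNReal.rpow_one, hA, mul_assoc]
    _ ≤ 2 ^ (p - 1) * (A + S ^ p) * (1 + D) := by
        rw [mul_assoc (2 ^ (p - 1))]
        refine mul_le_mul' le_rfl ?_
        rw [mul_add, mul_one, add_mul, add_comm (A * D)]
        exact add_le_add le_add_self le_self_add

lemma aemeasurable_bracket_rpow_mul_norm_rpow {μ : Measure (EuclideanSpace ℝ (Fin N))}
    (hu : AEMeasurable u μ) (hv : AEStronglyMeasurable v μ) (e p : ℝ) :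
    AEMeasurable (fun x => ENNReal.ofReal (bracket (u x) ^ e * ‖v x‖ ^ p)) μ :=
  (((continuous_bracket_rpow e).measurable.comp_aemeasurable hu).mul
    (hv.norm.aemeasurable.pow_const p)).ennreal_ofReal

/-- Bootstrapping the energy estimates with Sobolev's inequality. -/
lemma lintegral_bracket_lt_top (hΩb : Bornology.IsBounded Ω) (hp : 1 ≤ p) (hpN : p < N)
    {β s τ : ℝ} (hβ : 0 < β) (hs : 0 < s) (hτ : 0 ≤ τ) (hτ' : τ < p / sobolevConj N p)
    (hu : AEMeasurable u (volume.restrict Ω)) (hu0 : ∀ᵐ x ∂(volume.restrict Ω), 0 ≤ u x)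
    (hv : AEStronglyMeasurable v (volume.restrict Ω))
    (hW : ∀ k : ℝ, 0 < k → IsW0Limit Ω p (fun x => truncAt k (u x)) ({x | |u x| ≤ k}.indicator v))
    {B : ℝ≥0∞} (hB : B ≠ ⊤)
    (hE : ∀ j : ℕ, ∫⁻ x in Ω, {x | s < u x ∧ u x ≤ 2 ^ j * s}.indicator
        (fun x => ENNReal.ofReal (bracket (u x) ^ ((β - 1) * p) * ‖v x‖ ^ p)) x ≤
      B * (1 + (∫⁻ x in Ω, ENNReal.ofReal
        (bracket (truncAt (2 ^ j * s) (u x)) ^ (β * sobolevConj N p))) ^ τ)) :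
    ∫⁻ x in Ω, ENNReal.ofReal (bracket (u x) ^ (β * sobolevConj N p)) < ⊤ ∧
    ∫⁻ x in Ω, ENNReal.ofReal (bracket (u x) ^ ((β - 1) * p) * ‖v x‖ ^ p) < ⊤ := by
  have := isFiniteMeasure_restrict_of_isBounded hΩb
  have hp0 : 0 < p := by linarith
  have hq := sobolevConj_pos hp0 hpN
  obtain ⟨C, hCt, hC⟩ := exists_bracket_sobolev hΩb hp hpN hβ hW
  set q := sobolevConj N p with hqdef
  set E : EuclideanSpace ℝ (Fin N) → ℝ≥0∞ := fun x =>
    ENNReal.ofReal (bracket (u x) ^ ((β - 1) * p) * ‖v x‖ ^ p) with hEdef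
  have hEm : AEMeasurable E (volume.restrict Ω) :=
    aemeasurable_bracket_rpow_mul_norm_rpow hu hv _ _
  have ht : ∀ j : ℕ, 0 < 2 ^ j * s := fun j => by positivity
  set Y : ℕ → ℝ≥0∞ := fun j => ∫⁻ x in Ω, ENNReal.ofReal
    (bracket (truncAt (2 ^ j * s) (u x)) ^ (β * q)) with hY
  have hset : ∀ k, NullMeasurableSet {x | |u x| ≤ k} (volume.restrict Ω) := fun k =>
    nullMeasurableSet_le hu.abs aemeasurable_const
  set D₀ := ∫⁻ x in Ω, {x | |u x| ≤ s}.indicator E x with hD₀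
  -- Where |u| ≤ s the weight is bounded, and the energy is that of T_s(u).
  have hD₀t : D₀ ≠ ⊤ := by
    have hfin := lintegral_rpow_enorm_lt_top_of_eLpNorm_lt_top (by simpa using hp0)
      ENNReal.ofReal_ne_top (hW s hs).memLp_grad.2
    rw [ENNReal.toReal_ofReal hp0.le] at hfin
    have hle : D₀ ≤ ∫⁻ x in Ω, ENNReal.ofReal ((1 + s) ^ |(β - 1) * p|) *
        ‖{x | |u x| ≤ s}.indicator v x‖ₑ ^ p := by
      refine lintegral_mono fun x => ?_
      by_cases hx : |u x| ≤ s
      · rw [indicator_of_mem (by exact hx), indicator_of_mem (by exact hx),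
          ← ofReal_norm, ENNReal.ofReal_rpow_of_nonneg (norm_nonneg _) hp0.le,
          ← ENNReal.ofReal_mul (by positivity)]
        refine ENNReal.ofReal_le_ofReal ?_
        gcongr
        exact Real.rpow_le_rpow_abs_exponent (one_le_bracket _)
          ((bracket_le_one_add_abs _).trans (by linarith))
      · rw [indicator_of_notMem (by exact hx)]
        exact zero_le
    refine (hle.trans_lt ?_).ne
    rw [lintegral_const_mul' _ _ ENNReal.ofReal_ne_top]
    exact ENNReal.mul_lt_top ENNReal.ofReal_lt_top hfin
  have hD : ∀ j, ∫⁻ x in Ω, {x | |u x| ≤ 2 ^ j * s}.indicator E x ≤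
      (D₀ + B) * (1 + Y j ^ τ) := by
    intro j
    calc ∫⁻ x in Ω, {x | |u x| ≤ 2 ^ j * s}.indicator E x
        ≤ ∫⁻ x in Ω, ({x | |u x| ≤ s}.indicator E x +
            {x | s < u x ∧ u x ≤ 2 ^ j * s}.indicator E x) := by
          refine lintegral_mono_ae ?_
          filter_upwards [hu0] with x hx
          by_cases h1 : |u x| ≤ 2 ^ j * s
          · rw [indicator_of_mem (by exact h1)]
            by_cases h2 : |u x| ≤ s
            · rw [indicator_of_mem (by exact h2)]
              exact le_self_add
            · rw [abs_of_nonneg hx] at h1 h2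
              have h3 : s < u x ∧ u x ≤ 2 ^ j * s := ⟨not_le.1 h2, h1⟩
              rw [indicator_of_mem (a := x) (s := {x | s < u x ∧ u x ≤ 2 ^ j * s}) h3]
              exact le_add_self
          · rw [indicator_of_notMem (by exact h1)]
            exact zero_le
      _ = D₀ + ∫⁻ x in Ω, {x | s < u x ∧ u x ≤ 2 ^ j * s}.indicator E x :=
          lintegral_add_left' (hEm.indicator₀ (hset s)) _
      _ ≤ D₀ + B * (1 + Y j ^ τ) := add_le_add le_rfl (hE j)
      _ ≤ (D₀ + B) * (1 + Y j ^ τ) := by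
          rw [add_mul]
          gcongr
          exact le_mul_of_one_le_right' le_self_add
  -- The bound depends on j, but it serves only to license the absorption, whose outcome is uniform
  -- in j.
  have hYt : ∀ j, Y j ≠ ⊤ := by
    intro j
    have hle : Y j ≤ ∫⁻ _ in Ω, ENNReal.ofReal ((1 + 2 ^ j * s) ^ |β * q|) := by
      refine lintegral_mono fun x => ENNReal.ofReal_le_ofReal ?_
      refine Real.rpow_le_rpow_abs_exponent (one_le_bracket _) ?_
      exact (bracket_le_one_add_abs _).trans (by linarith [abs_truncAt_le (ht j).le (u x)])
    refine (hle.trans_lt ?_).ne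
    rw [lintegral_const]
    exact ENNReal.mul_lt_top ENNReal.ofReal_lt_top (measure_lt_top _ _)
  set C' : ℝ≥0∞ := C * (1 + (D₀ + B)) with hC'
  have hC't : C' ≠ ⊤ := ENNReal.mul_ne_top hCt (by simp [hD₀t, hB])
  have hYle : ∀ j, Y j ≤ max 1 ((2 * C') ^ (1 / (p / q - τ))) := by
    intro j
    refine ENNReal.le_max_of_rpow_le_mul_one_add_rpow hτ hτ' (hYt j) ((hC _ (ht j)).trans ?_)
    rw [hC', mul_assoc]
    gcongr
    rw [add_mul, one_mul]
    exact add_le_add le_self_add (hD j)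
  set M := max 1 ((2 * C') ^ (1 / (p / q - τ))) with hM
  have hMt : M ≠ ⊤ := by
    refine (max_lt ENNReal.one_lt_top (lt_top_iff_ne_top.2 ?_)).ne
    exact ENNReal.rpow_ne_top_of_nonneg (one_div_nonneg.2 (by linarith))
      (ENNReal.mul_ne_top (by simp) hC't)
  have hev : ∀ x, ∀ᶠ j : ℕ in atTop, |u x| ≤ 2 ^ j * s := fun x =>
    ((tendsto_pow_atTop_atTop_of_one_lt one_lt_two).atTop_mul_const hs).eventually_ge_atTop _
  refine ⟨(lintegral_le_of_eventually_eq (F := fun j x => ENNReal.ofReal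
    (bracket (truncAt (2 ^ j * s) (u x)) ^ (β * q))) (fun j => ?_) (fun x => ?_) hYle).trans_lt
    hMt.lt_top, (lintegral_le_of_eventually_eq (F := fun j =>
      {x | |u x| ≤ 2 ^ j * s}.indicator E) (M := (D₀ + B) * (1 + M ^ τ))
      (fun j => hEm.indicator₀ (hset _)) (fun x => ?_) (fun j => ?_)).trans_lt ?_⟩
  · exact (((continuous_bracket_rpow _).comp (continuous_truncAt _)).measurable.comp_aemeasurable
      hu).ennreal_ofReal
  · filter_upwards [hev x] with j hj
    rw [truncAt_of_abs_le hj]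
  · filter_upwards [hev x] with j hj
    rw [indicator_of_mem (by exact hj)]
  · refine (hD j).trans ?_
    gcongr
    exact hYle j
  · refine ENNReal.mul_lt_top (by simp [hD₀t.lt_top, hB.lt_top]) ?_
    simp [ENNReal.rpow_lt_top_of_nonneg hτ hMt]

end APriori

/-! ### Bounds for the source term. -/

section Source

variable {X : Type*} [MeasurableSpace X] {μ : Measure X}

lemma rpow_neg_mul_min_rpow_le {r t γ η : ℝ} (hr : 0 < r) (ht : 0 < t) (hγ : 0 ≤ γ) :
    r ^ (-γ) * min r t ^ η ≤ min r t ^ (η - γ) := by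
  have hm : 0 < min r t := lt_min hr ht
  rw [sub_eq_neg_add, Real.rpow_add hm]
  refine mul_le_mul_of_nonneg_right ?_ (by positivity)
  exact Real.rpow_le_rpow_of_nonpos hm (min_le_left _ _) (by linarith)

/-- The factor of f is at most min(u, 2^j s)^{η-γ}, which for η ≤ γ is largest at the bottom level
s: integrability of f suffices. -/
lemma lintegral_source_le_of_exponent_nonpos {u f : X → ℝ} {s γ η : ℝ} (hs : 0 < s) (hγ : 0 ≤ γ)
    (hη : η ≤ γ) (hf0 : ∀ᵐ x ∂μ, 0 ≤ f x) (j : ℕ) :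
    ∫⁻ x, {x | s < u x}.indicator
        (fun x => ENNReal.ofReal (f x * u x ^ (-γ) * min (u x) (2 ^ j * s) ^ η)) x ∂μ ≤
      ENNReal.ofReal (s ^ (η - γ)) * ∫⁻ x, ENNReal.ofReal (f x) ∂μ := by
  rw [← lintegral_const_mul' _ _ ENNReal.ofReal_ne_top]
  refine lintegral_mono_ae ?_
  filter_upwards [hf0] with x hx
  by_cases h : s < u x
  · rw [indicator_of_mem (by exact h), ← ENNReal.ofReal_mul (by positivity)]
    refine ENNReal.ofReal_le_ofReal ?_
    have hst : s ≤ 2 ^ j * s := le_mul_of_one_le_left hs.le (one_le_pow₀ one_le_two)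
    rw [mul_assoc, mul_comm]
    refine mul_le_mul_of_nonneg_right ?_ hx
    refine (rpow_neg_mul_min_rpow_le (hs.trans h) (hs.trans_le hst) hγ).trans ?_
    exact Real.rpow_le_rpow_of_nonpos hs (le_min h.le hst) (by linarith)
  · rw [indicator_of_notMem (by exact h)]
    exact zero_le

/-- Hölder with exponents r and r' = r/(r-1); ρ is (η-γ)r', the power that r' produces. -/
lemma lintegral_source_le_of_exponent_pos {u f : X → ℝ} {s γ η r ρ : ℝ} (hs : 0 < s) (hγ : 0 ≤ γ)
    (hη : γ < η) (hu : AEMeasurable u μ) (hf : AEMeasurable f μ) (hf0 : ∀ᵐ x ∂μ, 0 ≤ f x)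
    (hr : 1 < r) (hρ : (1 - 1 / r) * ρ = η - γ) (j : ℕ) :
    ∫⁻ x, {x | s < u x}.indicator
        (fun x => ENNReal.ofReal (f x * u x ^ (-γ) * min (u x) (2 ^ j * s) ^ η)) x ∂μ ≤
      (∫⁻ x, ENNReal.ofReal (f x) ^ r ∂μ) ^ (1 / r) *
        (∫⁻ x, ENNReal.ofReal (bracket (truncAt (2 ^ j * s) (u x)) ^ ρ) ∂μ) ^ (1 - 1 / r) := by
  have hconj : r.HolderConjugate (r / (r - 1)) := Real.HolderConjugate.conjExponent hr
  have hr' : 1 / (r / (r - 1)) = 1 - 1 / r := by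
    have : r - 1 ≠ 0 := by linarith
    have : r ≠ 0 := by linarith
    field_simp
  have hgm : AEMeasurable (fun x => ENNReal.ofReal
      (bracket (truncAt (2 ^ j * s) (u x)) ^ (η - γ))) μ :=
    (((continuous_bracket_rpow _).comp (continuous_truncAt _)).measurable.comp_aemeasurable
      hu).ennreal_ofReal
  have hH := ENNReal.lintegral_mul_le_Lp_mul_Lq μ hconj hf.ennreal_ofReal hgm
  rw [hr'] at hH
  have e : ∀ x, ENNReal.ofReal (bracket (truncAt (2 ^ j * s) (u x)) ^ (η - γ)) ^ (r / (r - 1)) =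
      ENNReal.ofReal (bracket (truncAt (2 ^ j * s) (u x)) ^ ρ) := by
    intro x
    have hB := bracket_pos (truncAt (2 ^ j * s) (u x))
    rw [ENNReal.ofReal_rpow_of_pos (by positivity), ← Real.rpow_mul hB.le, ← hρ]
    congr 2
    have : r - 1 ≠ 0 := by linarith
    have : r ≠ 0 := by linarith
    field_simp
  simp only [e] at hH
  refine le_trans (lintegral_mono_ae ?_) hH
  filter_upwards [hf0] with x hx
  simp only [Pi.mul_apply]
  by_cases h : s < u x
  · have hst : s ≤ 2 ^ j * s := le_mul_of_one_le_left hs.le (one_le_pow₀ one_le_two)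
    rw [indicator_of_mem (by exact h), ← ENNReal.ofReal_mul hx]
    refine ENNReal.ofReal_le_ofReal ?_
    rw [mul_assoc]
    refine mul_le_mul_of_nonneg_left ?_ hx
    refine (rpow_neg_mul_min_rpow_le (hs.trans h) (hs.trans_le hst) hγ).trans ?_
    have hm : 0 < min (u x) (2 ^ j * s) := lt_min (hs.trans h) (hs.trans_le hst)
    refine Real.rpow_le_rpow hm.le ?_ (by linarith)
    have : min (u x) (2 ^ j * s) ≤ truncAt (2 ^ j * s) (u x) := le_max_right _ _
    exact this.trans ((le_abs_self _).trans (abs_le_bracket _))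
  · rw [indicator_of_notMem (by exact h)]
    exact zero_le

end Source

/-! ### Weighted estimates for entropy solutions. -/

section Estimates

variable {N : ℕ} {Ω : Set (EuclideanSpace ℝ (Fin N))} {p : ℝ}

/-- Weighted estimates for entropy solutions. With `B = (p - 1)(1 - θ) + γ₂`, a power `β > 0` is
admissible for a datum in `L^1` if `β p ≤ B`, and for one in `L^r` if
`β p - B = (1 - 1 / r) β p^* > 0`. -/
lemma IsEntropySolution.lintegral_bracket_lt_top
    (hΩo : IsOpen Ω) (hΩb : Bornology.IsBounded Ω) (hp1 : 1 < p) (hpN : p < N)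
    {a : EuclideanSpace ℝ (Fin N) → ℝ → EuclideanSpace ℝ (Fin N) → EuclideanSpace ℝ (Fin N)}
    {b : ℝ → ℝ} {α τ : ℝ} (hα : 0 < α) (hτ : 0 ≤ τ)
    (hb : ∀ s : ℝ, α / (1 + |s|) ^ τ ≤ b s)
    (hab : ∀ᵐ x ∂(volume.restrict Ω), ∀ (s : ℝ) (ξ : EuclideanSpace ℝ (Fin N)),
      b s * ‖ξ‖ ^ p ≤ inner ℝ (a x s ξ) ξ)
    {h : ℝ≥0 → ℝ≥0∞} {c₂ s₂ γ₂ : ℝ} (hγ₂ : 0 ≤ γ₂) (hτγ : τ < p - 1 + γ₂) (hc₂ : 0 < c₂)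
    (hs₂ : 0 < s₂)
    (hh : ∀ s : ℝ≥0, s₂ ≤ (s : ℝ) → h s ≤ ENNReal.ofReal (c₂ / (s : ℝ) ^ γ₂))
    {f u : EuclideanSpace ℝ (Fin N) → ℝ} (hf0 : ∀ᵐ x ∂(volume.restrict Ω), 0 ≤ f x)
    (hf1 : Integrable f (volume.restrict Ω))
    (hu : IsEntropySolution Ω p a h f u) {β : ℝ} (hβ : 0 < β) (hβ' : 0 < β * p - (p - 1 - τ))
    (hβf : β * p ≤ p - 1 - τ + γ₂ ∨ p - 1 - τ + γ₂ < β * p ∧ ∃ r : ℝ, 1 < r ∧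
      MemLp f (ENNReal.ofReal r) (volume.restrict Ω) ∧
      (1 - 1 / r) * (β * sobolevConj N p) = β * p - (p - 1 - τ + γ₂)) :
    ∫⁻ x in Ω, ENNReal.ofReal (bracket (u x) ^ (β * sobolevConj N p)) < ⊤ ∧
    ∫⁻ x in Ω, ENNReal.ofReal (bracket (u x) ^ ((β - 1) * p) * ‖truncGrad Ω u x‖ ^ p) < ⊤ := by
  have hp0 : 0 < p := by linarith
  have hq := sobolevConj_pos hp0 hpN
  have hb0 : ∀ s, 0 ≤ b s := fun s => le_trans (by positivity) (hb s)
  have hvm := (isTruncGrad_truncGrad hΩo hΩb hp1.le hu.memW0_trunc).1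
  have hum := hu.aemeasurable
  have hfm := hf1.1.aemeasurable
  -- Here η = βp - (p-1-τ), the value for which the weight exponent η-1-τ equals (β-1)p.
  obtain ⟨C, hC⟩ := exists_weighted_energy_le (w := fun x => ‖truncGrad Ω u x‖ ^ p) hum
    (hvm.norm.aemeasurable.pow_const p) (fun x => by positivity) hfm hα hτ hb hc₂.le hs₂ hβ'
    (fun t ht => hu.lintegral_layer_le hΩo hΩb hp1 hb0 hab hc₂ hs₂ hh hf0 ht)
  have hexp : β * p - (p - 1 - τ) - 1 - τ = (β - 1) * p := by ring
  rw [hexp] at hC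
  have hW := fun (k : ℝ) (hk : 0 < k) =>
    isW0Limit_truncGrad hΩo hΩb hp1.le hu.memW0_trunc hk
  rcases hβf with hle | ⟨hlt, r, hr, hfr, hρ⟩
  · refine _root_.lintegral_bracket_lt_top hΩb hp1.le hpN hβ hs₂ le_rfl (by positivity) hum
      hu.nonneg hvm hW (B := ENNReal.ofReal C * (ENNReal.ofReal
        (s₂ ^ (β * p - (p - 1 - τ) - γ₂)) * ∫⁻ x in Ω, ENNReal.ofReal (f x))) ?_ fun j => ?_
    · exact ENNReal.mul_ne_top ENNReal.ofReal_ne_top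
        (ENNReal.mul_ne_top ENNReal.ofReal_ne_top hf1.lintegral_lt_top.ne)
    · refine (hC j).trans ((mul_le_mul' le_rfl (lintegral_source_le_of_exponent_nonpos hs₂ hγ₂
        (by linarith) hf0 j)).trans ?_)
      exact le_mul_of_one_le_right' le_self_add
  · have hr0 : 0 < r := by linarith
    have hτ' : 0 ≤ 1 - 1 / r := by
      rw [sub_nonneg, div_le_one hr0]
      exact hr.le
    refine _root_.lintegral_bracket_lt_top hΩb hp1.le hpN hβ hs₂ hτ' ?_ hum
      hu.nonneg hvm hW (B := ENNReal.ofReal C *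
        (∫⁻ x in Ω, ENNReal.ofReal (f x) ^ r) ^ (1 / r)) ?_ fun j => ?_
    -- Absorption needs 1 - 1/r < p/q; this is (1-1/r)qβ = βp - B < βp divided by βq.
    · rw [lt_div_iff₀ hq]
      have : (1 - 1 / r) * sobolevConj N p * β < p * β := by linarith
      exact lt_of_mul_lt_mul_right this hβ.le
    · refine ENNReal.mul_ne_top ENNReal.ofReal_ne_top
        (ENNReal.rpow_ne_top_of_nonneg (by positivity) ?_)
      have hfin := lintegral_rpow_enorm_lt_top_of_eLpNorm_lt_top (by simpa using hr0)
        ENNReal.ofReal_ne_top hfr.2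
      rw [ENNReal.toReal_ofReal hr0.le] at hfin
      refine (lt_of_le_of_lt (lintegral_mono fun x => ?_) hfin).ne
      exact ENNReal.rpow_le_rpow (Real.ofReal_le_enorm _) hr0.le
    · refine (hC j).trans ((mul_le_mul' le_rfl (lintegral_source_le_of_exponent_pos hs₂ hγ₂
        (ρ := β * sobolevConj N p) (by linarith) hum hfm hf0 hr (by linarith) j)).trans ?_)
      rw [← mul_assoc]
      exact mul_le_mul' le_rfl le_add_self

/-- Functions whose truncations are in `W^{1,p}_0`, with finite energy, are in `W^{1,p}_0`. -/
lemma isW0Limit_of_truncations (hp : 1 ≤ p) {u : EuclideanSpace ℝ (Fin N) → ℝ}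
    {v : EuclideanSpace ℝ (Fin N) → EuclideanSpace ℝ (Fin N)}
    (hu : MemLp u (ENNReal.ofReal p) (volume.restrict Ω))
    (hv : MemLp v (ENNReal.ofReal p) (volume.restrict Ω))
    (hW : ∀ k : ℝ, 0 < k → IsW0Limit Ω p (fun x => truncAt k (u x))
      ({x | |u x| ≤ k}.indicator v)) : IsW0Limit Ω p u v := by
  have hP0 : ENNReal.ofReal p ≠ 0 := by simpa using by linarith
  have hk : ∀ n : ℕ, (0 : ℝ) < n + 1 := fun n => by positivity
  have hev : ∀ x, ∀ᶠ n : ℕ in atTop, |u x| ≤ (n : ℝ) + 1 := fun x =>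
    (tendsto_atTop_add_const_right _ _ tendsto_natCast_atTop_atTop).eventually_ge_atTop _
  refine IsW0Limit.of_tendsto hp (fun n : ℕ => hW _ (hk n)) hu hv ?_ ?_
  · refine tendsto_eLpNorm_sub_of_dominated hP0 ENNReal.ofReal_ne_top
      (H := fun x => ‖u x‖ + ‖u x‖) (fun n => (hW _ (hk n)).memLp.1) hu.1 (hu.norm.add hu.norm)
      (fun n => Eventually.of_forall fun x => ?_) (Eventually.of_forall fun x => ?_)
    · exact (norm_sub_le _ _).trans (add_le_add le_rfl (abs_truncAt_le_abs (hk n).le _))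
    · refine tendsto_const_nhds.congr' ?_
      filter_upwards [hev x] with n hn
      rw [truncAt_of_abs_le hn]
  · refine tendsto_eLpNorm_sub_of_dominated hP0 ENNReal.ofReal_ne_top
      (H := fun x => ‖v x‖ + ‖v x‖) (fun n => (hW _ (hk n)).memLp_grad.1) hv.1
      (hv.norm.add hv.norm) (fun n => Eventually.of_forall fun x => ?_)
      (Eventually.of_forall fun x => ?_)
    · exact (norm_sub_le _ _).trans (add_le_add le_rfl (norm_indicator_le_norm_self _ _))
    · refine tendsto_const_nhds.congr' ?_
      filter_upwards [hev x] with n hn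
      rw [indicator_of_mem (by exact hn)]

lemma memLp_ofReal_of_lintegral_lt_top {X E : Type*} [MeasurableSpace X] {μ : Measure X}
    [NormedAddCommGroup E] {q : ℝ} (hq : 0 < q) {f : X → E} (hf : AEStronglyMeasurable f μ)
    (h : ∫⁻ x, ENNReal.ofReal (‖f x‖ ^ q) ∂μ < ⊤) : MemLp f (ENNReal.ofReal q) μ := by
  refine ⟨hf, ?_⟩
  rw [eLpNorm_ofReal_rpow_eq hq]
  exact ENNReal.rpow_lt_top_of_nonneg (by positivity) h.ne

end Estimates

/-! ### Interpolation by Young's inequality. -/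

section Young

/-- Interpolation between a weighted energy and a power of the bracket. -/
lemma rpow_le_bracket_add_bracket {p q e σ : ℝ} (hp : 0 < p) (hq : 0 < q) (hqp : q < p)
    (he : e * q + σ * (p - q) = 0) {r : ℝ} (hr : 0 ≤ r) (s : ℝ) :
    r ^ q ≤ bracket s ^ e * r ^ p + bracket s ^ σ := by
  have hB := bracket_pos s
  have h1 : 0 < q / p := by positivity
  have h2 : 0 < 1 - q / p := by
    rw [sub_pos, div_lt_one hp]
    exact hqp
  have hA0 : 0 ≤ bracket s ^ e * r ^ p := by positivity
  have hS0 : 0 ≤ bracket s ^ σ := by positivity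
  -- With weights q/p and 1 - q/p, the hypothesis `he` says precisely that the bracket cancels from
  -- the geometric mean.
  have key := Real.geom_mean_le_arith_mean2_weighted h1.le h2.le hA0 hS0 (by ring)
  have e1 : (bracket s ^ e * r ^ p) ^ (q / p) * (bracket s ^ σ) ^ (1 - q / p) = r ^ q := by
    rw [Real.mul_rpow (by positivity) (by positivity), ← Real.rpow_mul hB.le,
      ← Real.rpow_mul hr, ← Real.rpow_mul hB.le, mul_right_comm, ← Real.rpow_add hB]
    have e2 : e * (q / p) + σ * (1 - q / p) = 0 := by
      have : e * (q / p) + σ * (1 - q / p) = (e * q + σ * (p - q)) / p := by field_simp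
      rw [this, he, zero_div]
    rw [e2, Real.rpow_zero, one_mul, mul_div_cancel₀ _ hp.ne']
  rw [e1] at key
  refine key.trans (add_le_add ?_ ?_)
  · exact mul_le_of_le_one_left hA0 (by linarith)
  · exact mul_le_of_le_one_left hS0 (by linarith)

end Young

/-! ### The lemma: choice of exponents. -/

theorem lemma5p5 (N : ℕ) (hN : 2 ≤ N)
    (Ω : Set (EuclideanSpace ℝ (Fin N))) (hΩo : IsOpen Ω) (hΩb : Bornology.IsBounded Ω)
    (p : ℝ) (hp1 : 1 < p) (hpN : p < N)
    (θ γ₂ : ℝ) (hθ0 : 0 ≤ θ) (hγ₂ : 0 ≤ γ₂) (hθ : θ < 1 + γ₂ / (p - 1))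
    -- the operator
    (a : EuclideanSpace ℝ (Fin N) → ℝ → EuclideanSpace ℝ (Fin N) → EuclideanSpace ℝ (Fin N))
    (ha : IsCaratheodory Ω a)
    (b : ℝ → ℝ) (hbc : Continuous b) (hbb : ∃ M : ℝ, ∀ s : ℝ, |b s| ≤ M)
    (α : ℝ) (hα : 0 < α) (hb : ∀ s : ℝ, α / (1 + |s|) ^ (θ * (p - 1)) ≤ b s)
    (hab : ∀ᵐ x ∂(volume.restrict Ω), ∀ (s : ℝ) (ξ : EuclideanSpace ℝ (Fin N)),
      b s * ‖ξ‖ ^ p ≤ inner ℝ (a x s ξ) ξ)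
    -- the lower order term
    (h : ℝ≥0 → ℝ≥0∞) (hhc : ContinuousOn h {0}ᶜ) (hhfin : ∀ s : ℝ≥0, s ≠ 0 → h s ≠ ⊤)
    (c₂ s₂ : ℝ) (hc₂ : 0 < c₂) (hs₂ : 0 < s₂)
    (hh : ∀ s : ℝ≥0, s₂ ≤ (s : ℝ) → h s ≤ ENNReal.ofReal (c₂ / (s : ℝ) ^ γ₂))
    -- the datum
    (m : ℝ) (hm : 1 ≤ m) (f : EuclideanSpace ℝ (Fin N) → ℝ)
    (hf0 : ∀ᵐ x ∂(volume.restrict Ω), 0 ≤ f x)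
    (hf : MemLp f (ENNReal.ofReal m) (volume.restrict Ω))
    -- the solution
    (u : EuclideanSpace ℝ (Fin N) → ℝ) (hu : IsEntropySolution Ω p a h f u) :
    (1 < m → m < N / p →
      Integrable (fun x => u x ^ (N * m * ((p - 1) * (1 - θ) + γ₂) / (N - m * p)))
        (volume.restrict Ω)) ∧
    (max (sobolevConj N p / (sobolevConj N p - θ * (p - 1) - 1 + γ₂)) 1 ≤ m →
      MemW0 Ω p u) ∧
    (1 < m → m < sobolevConj N p / (sobolevConj N p - θ * (p - 1) - 1 + γ₂) →
      IsTruncGrad Ω u (truncGrad Ω u) ∧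
      Integrable (fun x => ‖truncGrad Ω u x‖ ^
          (N * m * ((p - 1) * (1 - θ) + γ₂) / (N - m * (θ * (p - 1) + 1 - γ₂))))
        (volume.restrict Ω)) := by
  have := isFiniteMeasure_restrict_of_isBounded hΩb
  have hp0 : 0 < p := by linarith
  have hNp : (0 : ℝ) < N - p := by linarith
  have hN0 : (0 : ℝ) < N := by linarith
  have hq := sobolevConj_pos hp0 hpN
  have hq' : sobolevConj N p * (N - p) = N * p := by
    unfold sobolevConj
    field_simp
  set q := sobolevConj N p with hqdef
  have hpq : p < q := by
    refine lt_of_mul_lt_mul_right ?_ hNp.le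
    rw [hq']
    nlinarith
  set τ := θ * (p - 1) with hτdef
  have hτ0 : 0 ≤ τ := mul_nonneg hθ0 (by linarith)
  have hτγ : τ < p - 1 + γ₂ := by
    have h1 : 0 < p - 1 := by linarith
    have := mul_lt_mul_of_pos_right hθ h1
    rwa [add_mul, div_mul_cancel₀ _ h1.ne', one_mul] at this
  set B := p - 1 - τ + γ₂ with hBdef
  have hB0 : 0 < B := by linarith
  have hB : (p - 1) * (1 - θ) + γ₂ = B := by rw [hBdef, hτdef]; ring
  have hκ : τ + 1 - γ₂ = p - B := by rw [hBdef]; ring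
  have hden : q - τ - 1 + γ₂ = q - (p - B) := by rw [hBdef]; ring
  rw [hB, hκ, hden]
  have hden0 : 0 < q - (p - B) := by linarith
  have hf1 : Integrable f (volume.restrict Ω) := hf.integrable (by simpa using hm)
  have hum := hu.aemeasurable
  have hT := isTruncGrad_truncGrad hΩo hΩb hp1.le hu.memW0_trunc
  have main := fun {β : ℝ} => hu.lintegral_bracket_lt_top hΩo hΩb hp1 hpN hα hτ0 hb hab hγ₂ hτγ
    hc₂ hs₂ hh hf0 hf1 (β := β)
  have hint : ∀ e : ℝ, ∫⁻ x in Ω, ENNReal.ofReal (bracket (u x) ^ e) < ⊤ →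
      Integrable (fun x => bracket (u x) ^ e) (volume.restrict Ω) := fun e he =>
    (lintegral_ofReal_ne_top_iff_integrable
      ((continuous_bracket_rpow e).comp_aestronglyMeasurable hum.aestronglyMeasurable)
      (Eventually.of_forall fun x => Real.rpow_nonneg (bracket_pos _).le _)).1 he.ne
  have hsub : 1 < m → m * p < N → 0 < N * m * B / (N - m * p) ∧
      ∃ β : ℝ, β * q = N * m * B / (N - m * p) ∧
      ∫⁻ x in Ω, ENNReal.ofReal (bracket (u x) ^ (β * q)) < ⊤ ∧
      ∫⁻ x in Ω, ENNReal.ofReal (bracket (u x) ^ ((β - 1) * p) * ‖truncGrad Ω u x‖ ^ p) < ⊤ := by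
    intro hm1 hmp
    have hd : 0 < N - m * p := by linarith
    have hm0 : 0 < m := by linarith
    have hσ : 0 < N * m * B / (N - m * p) := by positivity
    -- This β solves (1-1/m)βq = βp - B, the admissibility condition for r = m.
    have hβq : m * B * (N - p) / (p * (N - m * p)) * q = N * m * B / (N - m * p) := by
      have : q = N * p / (N - p) := by rw [← hq', mul_div_cancel_right₀ _ hNp.ne']
      rw [this]
      field_simp
    have hβp : m * B * (N - p) / (p * (N - m * p)) * p - B =
        N * (m - 1) * B / (N - m * p) := by
      field_simp
      ring
    have hδ : 0 < N * (m - 1) * B / (N - m * p) := by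
      have : 0 < m - 1 := by linarith
      positivity
    refine ⟨hσ, _, hβq, main (by positivity) (by linarith) (Or.inr ⟨by linarith, m, hm1, hf, ?_⟩)⟩
    rw [hβq, hβp]
    field_simp
  refine ⟨fun hm1 hmN => ?_, fun hmax => ?_, fun hm1 hmq => ?_⟩
  · obtain ⟨hσ, β, hβ, hX, -⟩ := hsub hm1 ((lt_div_iff₀ hp0).1 hmN)
    rw [hβ] at hX
    refine (hint _ hX).mono' (hum.pow_const _).aestronglyMeasurable ?_
    filter_upwards [hu.nonneg] with x hx
    rw [Real.norm_of_nonneg (by positivity)]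
    exact Real.rpow_le_rpow hx ((le_abs_self _).trans (abs_le_bracket _)) hσ.le
  · have hest : ∫⁻ x in Ω, ENNReal.ofReal (bracket (u x) ^ ((1 : ℝ) * q)) < ⊤ ∧
        ∫⁻ x in Ω, ENNReal.ofReal (bracket (u x) ^ (((1 : ℝ) - 1) * p) *
          ‖truncGrad Ω u x‖ ^ p) < ⊤ := by
      refine main one_pos (by linarith) ?_
      rw [one_mul]
      rcases le_or_gt p B with hpB | hpB
      · exact Or.inl hpB
      -- For β = 1 admissibility reads (1-1/r)q = p - B. This r is the threshold in (i), and f is in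
      -- L^r since r ≤ m on a bounded set.
      · refine Or.inr ⟨hpB, q / (q - (p - B)), ?_, ?_, ?_⟩
        · rw [one_lt_div hden0]
          linarith
        · exact hf.mono_exponent (ENNReal.ofReal_le_ofReal ((le_max_left _ _).trans hmax))
        · field_simp
          ring
    obtain ⟨hX, hD⟩ := hest
    simp only [one_mul, sub_self, zero_mul, Real.rpow_zero] at hX hD
    refine (isW0Limit_of_truncations hp1.le
      (memLp_ofReal_of_lintegral_lt_top hp0 hum.aestronglyMeasurable ?_)
      (memLp_ofReal_of_lintegral_lt_top hp0 hT.1 hD)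
      (fun k hk => isW0Limit_truncGrad hΩo hΩb hp1.le hu.memW0_trunc hk)).memW0 hΩb hp1.le
    refine (lintegral_mono fun x => ENNReal.ofReal_le_ofReal ?_).trans_lt hX
    exact (Real.rpow_le_rpow (norm_nonneg _) (abs_le_bracket _) hp0.le).trans
      (Real.rpow_le_rpow_of_exponent_le (one_le_bracket _) hpq.le)
  -- `hT` certifies that `truncGrad` is a genuine gradient rather than the default value 0.
  · refine ⟨hT, ?_⟩
    have hm0 : 0 < m := by linarith
    have hm' : m * (q - (p - B)) < q := (lt_div_iff₀ hden0).1 hmq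
    -- Cleared of denominators, the upper bound on m gives both mp < N, so that the first estimate
    -- applies, and ρ < p, so that Young does; the latter is an equivalent form.
    have hm'' : m * (N * p - (p - B) * (N - p)) < N * p := by
      have := mul_lt_mul_of_pos_right hm' hNp
      have e : m * (q - (p - B)) * (N - p) = m * (q * (N - p) - (p - B) * (N - p)) := by ring
      rwa [e, hq'] at this
    have hmp : m * p < N := by
      have : m * p * p < N * p := by
        have : 0 < m * B * (N - p) := by positivity
        nlinarith
      exact lt_of_mul_lt_mul_right this hp0.le
    obtain ⟨hσ, β, hβ, hX, hD⟩ := hsub hm1 hmp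
    have hd : 0 < N - m * p := by linarith
    have hd' : 0 < N - m * (p - B) := by
      have : 0 < m * B := by positivity
      linarith
    set σ := N * m * B / (N - m * p) with hσdef
    set ρ := N * m * B / (N - m * (p - B)) with hρdef
    have hρ0 : 0 < ρ := by positivity
    have hρp : ρ < p := by
      rw [hρdef, div_lt_iff₀ hd']
      linarith
    have hβ' : β = m * B * (N - p) / (p * (N - m * p)) := by
      have h1 : β * (N * p) = σ * (N - p) := by rw [← hq', ← hβ]; ring
      have h2 : β = σ * (N - p) / (N * p) := by rw [← h1]; field_simp
      rw [h2, hσdef]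
      field_simp
    -- The balance required by Young's inequality; it determines ρ from β and σ = βq.
    have he : (β - 1) * p * ρ + σ * (p - ρ) = 0 := by
      rw [hβ', hσdef, hρdef]
      field_simp
      ring
    rw [hβ] at hX
    have hDi : Integrable (fun x => bracket (u x) ^ ((β - 1) * p) * ‖truncGrad Ω u x‖ ^ p)
        (volume.restrict Ω) := by
      refine (lintegral_ofReal_ne_top_iff_integrable ?_ (Eventually.of_forall fun x => ?_)).1 hD.ne
      · exact (((continuous_bracket_rpow _).measurable.comp_aemeasurable hum).mul
          (hT.1.norm.aemeasurable.pow_const p)).aestronglyMeasurable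
      · have := bracket_pos (u x)
        show 0 ≤ bracket (u x) ^ ((β - 1) * p) * ‖truncGrad Ω u x‖ ^ p
        positivity
    refine (hDi.add (hint _ hX)).mono' (hT.1.norm.aemeasurable.pow_const _).aestronglyMeasurable
      (Eventually.of_forall fun x => ?_)
    rw [Real.norm_of_nonneg (by positivity)]
    exact rpow_le_bracket_add_bracket hp0 hρ0 hρp he (norm_nonneg _) _
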